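/- Let $y_t$ be the tritronquée solution of the Painlevé equation $y''=6y^2+z$ determined as follows: for large $z$ in the sector $-3\pi/5<\arg z<\pi$ (that is, in every closed subsector, for all sufficiently large $|z|$) it is analytic, solves the equation, and satisfies $$y(z)=i\sqrt{z/6}\,\bigl(1+O(z^{-5/2})\bigr),\qquad z\to\infty,$$ with the principal square root. Such a solution exists, and it continues analytically from infinity to the origin along the ray $\arg z=\pi/5$ (to an open set containing the closed ray $\{se^{i\pi/5}:s\ge 0\}$). Put $g(t)=e^{2\pi i/5}\,y_t(-te^{i\pi/5})$, where $y_t$ denotes this continuation; thus $g''=6g^2+t$. Then the Maclaurin series $\sum_{n\ge0}\frac{g^{(n)}(0)}{n!}t^n$ of $g$ at $t=0$ has radius of convergence at least $37/20=1.85$. -/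

import Mathlib

open Filter Topology Bornology
open scoped ENNReal Nat

noncomputable section

/-- The closed subsector `-3π/5 + ε ≤ arg z ≤ π - ε` of the open sector `-3π/5 < arg z < π` of
opening `8π/5`. -/
def tritronqueeSector (ε : ℝ) : Set ℂ :=
  {z | -(3 * Real.pi / 5) + ε ≤ z.arg ∧ z.arg ≤ Real.pi - ε}

/-- `z → ∞` inside the closed subsector `-3π/5 + ε ≤ arg z ≤ π - ε`. -/
def sectorAtInfinity (ε : ℝ) : Filter ℂ :=
  cobounded ℂ ⊓ 𝓟 (tritronqueeSector ε)

/-- `y` is the tritronquée solution of `y'' = 6 y² + z` with `y(z) = i √(z/6) (1 + O(z^(-5/2)))`: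
for large `z` in the sector `-3π/5 < arg z < π` (as usual, in every closed subsector)
it is analytic, solves the equation, and has this behaviour.  The square root is the principal one.
Nothing is required of the values of `y` elsewhere. -/
structure IsTritronquee (y : ℂ → ℂ) : Prop where
  analytic : ∀ ε : ℝ, 0 < ε → ∀ᶠ z in sectorAtInfinity ε, AnalyticAt ℂ y z
  painleve : ∀ ε : ℝ, 0 < ε → ∀ᶠ z in sectorAtInfinity ε, deriv (deriv y) z = 6 * y z ^ 2 + z
  asymptotic : ∀ ε : ℝ, 0 < ε →
    (fun z : ℂ => y z / (Complex.I * (z / 6) ^ (1 / 2 : ℂ)) - 1)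
      =O[sectorAtInfinity ε] (fun z : ℂ => ‖z‖ ^ (-(5 / 2) : ℝ))

/-- The point `s e^{iπ/5}` of the ray bisecting the sector `-3π/5 < arg z < π`. -/
def bisectorPoint (s : ℝ) : ℂ :=
  (s : ℂ) * Complex.exp (Real.pi * Complex.I / 5)

/-- `Y` on the open set `D` is an analytic continuation of `y` from `∞` to the origin along the
closed ray `{s e^{iπ/5} : s ≥ 0}`.  (The ray is connected, so the germ of `Y` along the ray is
determined by `y`.) -/
structure IsContinuationToOrigin (y : ℂ → ℂ) (D : Set ℂ) (Y : ℂ → ℂ) : Prop where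
  isOpen : IsOpen D
  ray_mem : ∀ s : ℝ, 0 ≤ s → bisectorPoint s ∈ D
  differentiableOn : DifferentiableOn ℂ Y D
  eventually_eq : ∀ᶠ s : ℝ in atTop, Y (bisectorPoint s) = y (bisectorPoint s)

/-- The rotated function `g(t) = e^{2πi/5} y(-t e^{iπ/5})`. -/
def rotated (y : ℂ → ℂ) (t : ℂ) : ℂ :=
  Complex.exp (2 * Real.pi * Complex.I / 5) * y (-t * Complex.exp (Real.pi * Complex.I / 5))

/-- The Maclaurin series `∑ g⁽ⁿ⁾(0) / n! tⁿ` of `g`. -/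
def maclaurinSeries (g : ℂ → ℂ) : FormalMultilinearSeries ℂ ℂ ℂ :=
  FormalMultilinearSeries.ofScalars ℂ (fun n : ℕ => iteratedDeriv n g 0 / (n ! : ℂ))

end

/-!
Put `u(x) = g(-x)`, where `g(t) = e^{2πi/5} y(-t e^{iπ/5})`. Then `u'' = 6u² - x`, the ray
`arg z = π/5` becomes the positive half-line, and the tritronquée behaviour becomes
`u(x) = -√(x/6) + O(x⁻²)`.

*Existence.* Write `y = i√(z/6) - z⁻²/48 + z^(-1/8) W(ξ)` with the WKB variable `ξ = λ z^(5/4)`,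
`λ² = -(192/25) i√(1/6)`. The equation becomes
`W'' + W = A ξ⁻² W + B ξ^(-1/2) W² + C ξ^(-7/2)`, and the sector `-3π/5 < arg z < π` becomes the
plane cut along the negative half-line (`ofNormalized_solves`). A solution is a fixed point of
`W ↦ ∫₀^∞ sin(s) f(ξ + s) ds`, where `f` is the right-hand side: every integration runs along a
horizontal half-line to the right, on which `sin` stays bounded, and the region `rightRegion K` is
invariant under these translations and contains every closed subsector of the cut plane near
infinity. There the operator is a contraction for large `K` (`exists_small_solution`).

*Control on the half-line.* Let `g₀` be the explicit approximate solution `approx`, a Laurent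
polynomial in `τ = (1 + 2x/3)^(-1/2)` with residual at most `29/10000 τ³`, and put `w = u - g₀`.
Since `-12 g₀` is positive and increasing in `x`, the energy `|w'|² - 12 g₀ |w|²` cannot rise above
`(98/10000 τ)²` as `x` decreases: at contact the differential inequality `lt_deriv_energy` prevents
a crossing. The asymptotics, which may be differentiated by Cauchy's estimate, put the energy below
the barrier near infinity, hence it stays below all the way (`energy_le`).

*Continuation.* The energy bound controls `u` and `u'` at every point of the half-line, and the
power series solution has a radius bounded below in terms of these values. So the solution continues
by steps of fixed length from infinity past the origin (`exists_continuation`).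

*Radius.* The Taylor coefficients of `(ρ - t)⁻² = ∑ (n + 1) tⁿ / ρ^(n + 2)` satisfy the recursion of
`G'' = 6G²`. Hence they dominate those of `u` as soon as they do so for the first four
(`norm_painleveCoeff_le`), and the bounds at `x = 0`, namely `|u(0) + 749/4000| ≤ 98/10000` and
`|u'(0) + 611/2000| ≤ 98/10000`, allow `ρ = 37/20` (`SolvesOn.exists_ball`). Any other continuation
along the ray has the same germ at the origin by the identity theorem.
-/

noncomputable section

/-! ### Power series solutions of `u'' = 6 u² - x` -/

/-- `u` is an analytic solution of `u'' = 6 u² - x` on the open set `S`.  This is the equation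
satisfied by `x ↦ g (-x)`, for which the ray of the problem becomes the positive half-line. -/
def SolvesOn (u : ℂ → ℂ) (S : Set ℂ) : Prop :=
  DifferentiableOn ℂ u S ∧ ∀ x ∈ S, deriv (deriv u) x = 6 * u x ^ 2 - x

theorem summable_of_le_succ_pow_div_pow {c : ℕ → ℂ} {C ρ : ℝ} {k : ℕ}
    (hc : ∀ n, ‖c n‖ ≤ C * (n + 1) ^ k / ρ ^ n) {r : ℝ} (hr0 : 0 < r) (hr : r < ρ) :
    Summable fun n => ‖c n‖ * r ^ n := by
  have hρ : 0 < ρ := hr0.trans hr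
  have hq : 0 < r / ρ := by positivity
  have hq1 : ‖r / ρ‖ < 1 := by
    rw [Real.norm_of_nonneg hq.le]; exact (div_lt_one hρ).2 hr
  have h0 : Summable fun n : ℕ => (n : ℝ) ^ k * (r / ρ) ^ n :=
    summable_pow_mul_geometric_of_norm_lt_one k hq1
  have h1 : Summable fun n : ℕ => ((n + 1 : ℕ) : ℝ) ^ k * (r / ρ) ^ (n + 1) :=
    (summable_nat_add_iff (f := fun n : ℕ => (n : ℝ) ^ k * (r / ρ) ^ n) 1).2 h0
  have h2 := h1.mul_left (C * (r / ρ)⁻¹)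
  refine Summable.of_nonneg_of_le (fun n => by positivity) (fun n => ?_) h2
  calc ‖c n‖ * r ^ n ≤ (C * (n + 1) ^ k / ρ ^ n) * r ^ n := by gcongr; exact hc n
    _ = C * (r / ρ)⁻¹ * (((n + 1 : ℕ) : ℝ) ^ k * (r / ρ) ^ (n + 1)) := by
      push_cast; rw [pow_succ (r / ρ), div_pow]; field_simp

theorem hasDerivAt_tsum_mul_pow {c : ℕ → ℂ} {C ρ : ℝ} {k : ℕ}
    (hc : ∀ n, ‖c n‖ ≤ C * (n + 1) ^ k / ρ ^ n) {t : ℂ} (ht : ‖t‖ < ρ) :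
    HasDerivAt (fun t => ∑' n, c n * t ^ n) (∑' n : ℕ, (n + 1) * c (n + 1) * t ^ n) t := by
  have hn := norm_nonneg t
  obtain ⟨r, hr1, hr2⟩ := exists_between ht
  have hr0 : 0 < r := hn.trans_lt hr1
  have hu := summable_of_le_succ_pow_div_pow hc hr0 hr2
  have hd : ∀ i : ℕ, DifferentiableOn ℂ (fun t : ℂ => c i * t ^ i) (Metric.ball 0 r) :=
    fun i => by fun_prop
  have hle : ∀ (i : ℕ) (w : ℂ), w ∈ Metric.ball (0 : ℂ) r → ‖c i * w ^ i‖ ≤ ‖c i‖ * r ^ i := by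
    intro i w hw
    rw [norm_mul, norm_pow]
    gcongr
    exact (mem_ball_zero_iff.1 hw).le
  have hmem : t ∈ Metric.ball (0 : ℂ) r := mem_ball_zero_iff.2 hr1
  have h1 := Complex.hasSum_deriv_of_summable_norm hu hd Metric.isOpen_ball hle hmem
  have h2 := (Complex.differentiableOn_tsum_of_summable_norm hu hd Metric.isOpen_ball
    hle).differentiableAt (Metric.isOpen_ball.mem_nhds hmem)
  have h3 : deriv (fun w => ∑' i, c i * w ^ i) t = ∑' n : ℕ, (n + 1) * c (n + 1) * t ^ n := by
    rw [← h1.tsum_eq, h1.summable.tsum_eq_zero_add]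
    simp only [deriv_const_mul_field', deriv_pow_field, Nat.cast_zero, zero_mul, mul_zero,
      zero_add, Nat.cast_add, Nat.cast_one, Nat.add_sub_cancel]
    exact tsum_congr fun n => by ring
  rw [← h3]
  exact h2.hasDerivAt

theorem norm_succ_mul_le {c : ℕ → ℂ} {C ρ : ℝ} {k : ℕ} (hρ : 0 < ρ)
    (hc : ∀ n, ‖c n‖ ≤ C * (n + 1) ^ k / ρ ^ n) (n : ℕ) :
    ‖((n : ℂ) + 1) * c (n + 1)‖ ≤ (C * 2 ^ k / ρ) * (n + 1) ^ (k + 1) / ρ ^ n := by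
  have hC : 0 ≤ C := by simpa using (norm_nonneg _).trans (hc 0)
  have h1 : ‖(n : ℂ) + 1‖ = n + 1 := by
    rw [← Nat.cast_succ, Complex.norm_natCast]; push_cast; rfl
  rw [norm_mul, h1]
  calc ((n : ℝ) + 1) * ‖c (n + 1)‖
      ≤ (n + 1) * (C * (((n + 1 : ℕ) : ℝ) + 1) ^ k / ρ ^ (n + 1)) := by gcongr; exact hc _
    _ ≤ (n + 1) * (C * (2 * (n + 1)) ^ k / ρ ^ (n + 1)) := by
        gcongr; push_cast; linarith [Nat.cast_nonneg (α := ℝ) n]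
    _ = _ := by rw [mul_pow, pow_succ, pow_succ]; field_simp

/-- Taylor coefficients at `x₀` of the solution of `u'' = 6 u² - x` with `u x₀ = a`,
`u' x₀ = b`. -/
def painleveCoeff (a b x₀ : ℂ) : ℕ → ℂ
  | 0 => a
  | 1 => b
  | n + 2 => (6 * ∑ k : Fin (n + 1), painleveCoeff a b x₀ k * painleveCoeff a b x₀ (n - k)
      - (if n = 0 then x₀ else 0) - (if n = 1 then 1 else 0)) / ((n + 1) * (n + 2))
decreasing_by all_goals omega

theorem painleveCoeff_add_two (a b x₀ : ℂ) (n : ℕ) :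
    ((n : ℂ) + 1) * ((n + 2) * painleveCoeff a b x₀ (n + 2)) =
      6 * ∑ k ∈ Finset.range (n + 1), painleveCoeff a b x₀ k * painleveCoeff a b x₀ (n - k)
        - (if n = 0 then x₀ else 0) - (if n = 1 then 1 else 0) := by
  have h1 : (n : ℂ) + 1 ≠ 0 := by exact_mod_cast Nat.succ_ne_zero n
  have h2 : (n : ℂ) + 2 ≠ 0 := by exact_mod_cast Nat.succ_ne_zero (n + 1)
  rw [painleveCoeff, Fin.sum_univ_eq_sum_range
    (fun k => painleveCoeff a b x₀ k * painleveCoeff a b x₀ (n - k))]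
  field_simp

theorem sum_succ_mul_sub_succ (n : ℕ) :
    ∑ k ∈ Finset.range (n + 1), ((k : ℝ) + 1) * (((n - k : ℕ) : ℝ) + 1) =
      (n + 1) * (n + 2) * (n + 3) / 6 := by
  have key : ∀ (x : ℝ) (m : ℕ), ∑ k ∈ Finset.range (m + 1), ((k : ℝ) + 1) * (x - k + 1) =
      (m + 1) * (m + 2) / 2 * (x + 1) - m * (m + 1) * (m + 2) / 3 := by
    intro x m
    induction m with
    | zero => simp
    | succ m ih => rw [Finset.sum_range_succ, ih]; push_cast; ring
  rw [Finset.sum_congr rfl (g := fun k : ℕ => ((k : ℝ) + 1) * ((n : ℝ) - k + 1)), key n n]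
  · ring
  · intro k hk
    rw [Nat.cast_sub (Nat.lt_succ_iff.1 (Finset.mem_range.1 hk))]

/-- The double pole `(ρ - t)⁻² = ∑ (n + 1) tⁿ / ρⁿ⁺²` solves `G'' = 6 G²`, so its coefficients
reproduce themselves under the recursion; they majorize every solution whose first four Taylor
coefficients they majorize. -/
theorem norm_painleveCoeff_le {a b x₀ : ℂ} {ρ : ℝ} (hρ : 0 < ρ) (h0 : ‖a‖ ≤ 1 / ρ ^ 2)
    (h1 : ‖b‖ ≤ 2 / ρ ^ 3) (h2 : ‖3 * a ^ 2 - x₀ / 2‖ ≤ 3 / ρ ^ 4)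
    (h3 : ‖(12 * a * b - 1) / 6‖ ≤ 4 / ρ ^ 5) (n : ℕ) :
    ‖painleveCoeff a b x₀ n‖ ≤ (n + 1) / ρ ^ (n + 2) := by
  induction n using Nat.strong_induction_on with
  | _ n ih =>
    match n, ih with
    | 0, _ => simpa [painleveCoeff] using h0
    | 1, _ =>
      rw [painleveCoeff]
      refine h1.trans (le_of_eq ?_)
      norm_num
    | 2, _ =>
      have e : painleveCoeff a b x₀ 2 = 3 * a ^ 2 - x₀ / 2 := by
        simp [painleveCoeff]; ring
      rw [e]
      refine h2.trans (le_of_eq ?_)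
      norm_num
    | 3, _ =>
      have e : painleveCoeff a b x₀ 3 = (12 * a * b - 1) / 6 := by
        simp [painleveCoeff, Fin.sum_univ_two]; ring
      rw [e]
      refine h3.trans (le_of_eq ?_)
      norm_num
    | n + 4, ih =>
      have h := painleveCoeff_add_two a b x₀ (n + 2)
      simp only [Nat.add_eq_zero_iff, OfNat.ofNat_ne_zero, and_false, if_false,
        show ¬ (n + 2 = 1) by omega, sub_zero] at h
      have hs : ‖∑ k ∈ Finset.range (n + 2 + 1),
          painleveCoeff a b x₀ k * painleveCoeff a b x₀ (n + 2 - k)‖ ≤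
          ((n + 2 : ℕ) + 1) * ((n + 2 : ℕ) + 2) * ((n + 2 : ℕ) + 3) / 6 / ρ ^ (n + 6) := by
        rw [← sum_succ_mul_sub_succ (n + 2), Finset.sum_div]
        refine norm_sum_le_of_le _ fun k hk => ?_
        have hk' : k ≤ n + 2 := Nat.lt_succ_iff.1 (Finset.mem_range.1 hk)
        rw [norm_mul]
        calc _ ≤ ((k : ℝ) + 1) / ρ ^ (k + 2) *
              ((((n + 2 - k : ℕ) : ℝ) + 1) / ρ ^ (n + 2 - k + 2)) := by
              gcongr
              · exact ih k (by omega)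
              · exact ih _ (by omega)
          _ = _ := by
              rw [div_mul_div_comm, ← pow_add]
              congr 2
              omega
      have hn : ‖(((n + 2 : ℕ) : ℂ) + 1) * ((((n + 2 : ℕ) : ℂ) + 2) *
          painleveCoeff a b x₀ (n + 2 + 2))‖ =
          ((n + 2 : ℕ) + 1) * (((n + 2 : ℕ) + 2) * ‖painleveCoeff a b x₀ (n + 4)‖) := by
        rw [norm_mul, norm_mul]
        have e1 : ‖((n + 2 : ℕ) : ℂ) + 1‖ = ((n + 2 : ℕ) : ℝ) + 1 := by
          rw [← Nat.cast_succ, Complex.norm_natCast]; push_cast; rfl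
        have e2 : ‖((n + 2 : ℕ) : ℂ) + 2‖ = ((n + 2 : ℕ) : ℝ) + 2 := by
          have : ((n + 2 : ℕ) : ℂ) + 2 = ((n + 2 + 2 : ℕ) : ℂ) := by push_cast; ring
          rw [this, Complex.norm_natCast]; push_cast; ring
        rw [e1, e2]
      rw [h, norm_mul] at hn
      have h6 : ‖(6 : ℂ)‖ = 6 := by simp
      rw [h6] at hn
      have hpos : (0 : ℝ) < ((n + 2 : ℕ) + 1) * ((n + 2 : ℕ) + 2) := by positivity
      refine le_of_mul_le_mul_left ?_ hpos
      calc _ = 6 * ‖∑ k ∈ Finset.range (n + 2 + 1),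
            painleveCoeff a b x₀ k * painleveCoeff a b x₀ (n + 2 - k)‖ := by rw [hn]; ring
        _ ≤ 6 * (((n + 2 : ℕ) + 1) * ((n + 2 : ℕ) + 2) * ((n + 2 : ℕ) + 3) / 6 /
            ρ ^ (n + 6)) := by gcongr
        _ = _ := by push_cast; ring

/-- Local existence with an explicit radius: the hypotheses are the majorant bounds on the first
four Taylor coefficients. -/
theorem exists_solvesOn_ball {a b x₀ : ℂ} {ρ : ℝ} (hρ : 0 < ρ) (h0 : ‖a‖ ≤ 1 / ρ ^ 2)
    (h1 : ‖b‖ ≤ 2 / ρ ^ 3) (h2 : ‖3 * a ^ 2 - x₀ / 2‖ ≤ 3 / ρ ^ 4)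
    (h3 : ‖(12 * a * b - 1) / 6‖ ≤ 4 / ρ ^ 5) :
    ∃ u : ℂ → ℂ, SolvesOn u (Metric.ball x₀ ρ) ∧ u x₀ = a ∧ deriv u x₀ = b := by
  set c := painleveCoeff a b x₀ with hcdef
  have hc : ∀ n, ‖c n‖ ≤ (1 / ρ ^ 2) * (n + 1) ^ 1 / ρ ^ n := fun n => by
    refine (norm_painleveCoeff_le hρ h0 h1 h2 h3 n).trans (le_of_eq ?_)
    rw [pow_add]; field_simp
  have hc' := norm_succ_mul_le hρ hc
  set c' : ℕ → ℂ := fun n => ((n : ℂ) + 1) * c (n + 1) with hc'def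
  have hd1 : ∀ x ∈ Metric.ball x₀ ρ, HasDerivAt (fun x => ∑' n, c n * (x - x₀) ^ n)
      (∑' n, c' n * (x - x₀) ^ n) x := by
    intro x hx
    have := (hasDerivAt_tsum_mul_pow hc (t := x - x₀) (mem_ball_iff_norm.1 hx)).comp x
      ((hasDerivAt_id x).sub_const x₀)
    simpa [Function.comp_def, hc'def] using this
  have hd2 : ∀ x ∈ Metric.ball x₀ ρ, HasDerivAt (fun x => ∑' n, c' n * (x - x₀) ^ n)
      (∑' n : ℕ, ((n : ℂ) + 1) * c' (n + 1) * (x - x₀) ^ n) x := by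
    intro x hx
    have := (hasDerivAt_tsum_mul_pow hc' (t := x - x₀) (mem_ball_iff_norm.1 hx)).comp x
      ((hasDerivAt_id x).sub_const x₀)
    simpa only [Function.comp_def, id, mul_one] using this
  refine ⟨fun x => ∑' n, c n * (x - x₀) ^ n, ⟨fun x hx =>
    (hd1 x hx).differentiableAt.differentiableWithinAt, fun x hx => ?_⟩, ?_, ?_⟩
  · have he : deriv (fun x => ∑' n, c n * (x - x₀) ^ n) =ᶠ[𝓝 x]
        fun x => ∑' n, c' n * (x - x₀) ^ n := by
      filter_upwards [Metric.isOpen_ball.mem_nhds hx] with y hy using (hd1 y hy).deriv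
    rw [he.deriv_eq, (hd2 x hx).deriv]
    have ht : ‖x - x₀‖ < ρ := mem_ball_iff_norm.1 hx
    obtain ⟨r, hr1, hr2⟩ := exists_between ht
    have hr0 : 0 < r := (norm_nonneg _).trans_lt hr1
    have hs : Summable fun n => ‖c n * (x - x₀) ^ n‖ := by
      refine Summable.of_nonneg_of_le (fun n => norm_nonneg _) (fun n => ?_)
        (summable_of_le_succ_pow_div_pow hc hr0 hr2)
      rw [norm_mul, norm_pow]; gcongr
    have hprod := tsum_mul_tsum_eq_tsum_sum_range_of_summable_norm hs hs
    have hprods := (summable_norm_sum_mul_range_of_summable_norm hs hs).of_norm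
    have hx1 : HasSum (fun n : ℕ => if n = 0 then x₀ else 0) x₀ := by
      simpa using hasSum_ite_eq (0 : ℕ) x₀
    have hx2 : HasSum (fun n : ℕ => if n = 1 then (x - x₀) else 0) (x - x₀) := by
      simpa using hasSum_ite_eq (1 : ℕ) (x - x₀)
    have hall := ((hprods.hasSum.mul_left 6).sub hx1).sub hx2
    rw [← hprod] at hall
    dsimp only
    rw [show 6 * (∑' n, c n * (x - x₀) ^ n) ^ 2 - x =
      6 * ((∑' n, c n * (x - x₀) ^ n) * ∑' n, c n * (x - x₀) ^ n) - x₀ - (x - x₀) by ring,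
      ← hall.tsum_eq]
    refine tsum_congr fun n => ?_
    have hrec := painleveCoeff_add_two a b x₀ n
    rw [← hcdef] at hrec
    have e1 : ((n : ℂ) + 1) * c' (n + 1) = ((n : ℂ) + 1) * ((n + 2) * c (n + 2)) := by
      simp only [hc'def]; push_cast; ring
    have e2 : ∑ k ∈ Finset.range (n + 1), c k * (x - x₀) ^ k * (c (n - k) * (x - x₀) ^ (n - k)) =
        (∑ k ∈ Finset.range (n + 1), c k * c (n - k)) * (x - x₀) ^ n := by
      rw [Finset.sum_mul]
      refine Finset.sum_congr rfl fun k hk => ?_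
      have : (x - x₀) ^ n = (x - x₀) ^ k * (x - x₀) ^ (n - k) := by
        rw [← pow_add]; congr 1
        have := Finset.mem_range.1 hk
        omega
      rw [this]; ring
    rw [e1, hrec, e2]
    rcases n with _ | _ | n
    · simp
    · simp; ring
    · simp; ring
  · have := hasSum_single (f := fun n : ℕ => c n * (x₀ - x₀) ^ n) 0
      (fun n hn => by simp [hn])
    simpa [hcdef, painleveCoeff] using this.tsum_eq
  · rw [(hd1 x₀ (Metric.mem_ball_self hρ)).deriv]
    have := hasSum_single (f := fun n : ℕ => c' n * (x₀ - x₀) ^ n) 0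
      (fun n hn => by simp [hn])
    simpa [hc'def, hcdef, painleveCoeff] using this.tsum_eq

theorem SolvesOn.mono {u : ℂ → ℂ} {S T : Set ℂ} (h : SolvesOn u S) (hT : T ⊆ S) : SolvesOn u T :=
  ⟨h.1.mono hT, fun x hx => h.2 x (hT hx)⟩

theorem SolvesOn.congr {u v : ℂ → ℂ} {S : Set ℂ} (h : SolvesOn u S) (hS : IsOpen S)
    (huv : ∀ x ∈ S, v x = u x) : SolvesOn v S := by
  refine ⟨h.1.congr huv, fun x hx => ?_⟩
  have e : v =ᶠ[𝓝 x] u := by filter_upwards [hS.mem_nhds hx] with y hy using huv y hy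
  rw [e.deriv.deriv_eq, h.2 x hx, huv x hx]

theorem SolvesOn.hasDerivAt {u : ℂ → ℂ} {S : Set ℂ} (h : SolvesOn u S) (hS : IsOpen S) {x : ℂ}
    (hx : x ∈ S) : HasDerivAt u (deriv u x) x :=
  (h.1.differentiableAt (hS.mem_nhds hx)).hasDerivAt

theorem SolvesOn.hasDerivAt_deriv {u : ℂ → ℂ} {S : Set ℂ} (h : SolvesOn u S) (hS : IsOpen S)
    {x : ℂ} (hx : x ∈ S) : HasDerivAt (deriv u) (6 * u x ^ 2 - x) x := by
  rw [← h.2 x hx]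
  exact ((h.1.deriv hS).differentiableAt (hS.mem_nhds hx)).hasDerivAt

/-- Two functions analytic at the real point `x₀` which agree on a real interval to the right of
`x₀` agree near `x₀`. -/
theorem eventuallyEq_of_eq_right {u v : ℂ → ℂ} {x₀ : ℝ} (hu : AnalyticAt ℂ u x₀)
    (hv : AnalyticAt ℂ v x₀) (h : ∀ᶠ s : ℝ in 𝓝[>] x₀, u s = v s) : u =ᶠ[𝓝 (x₀ : ℂ)] v := by
  refine (AnalyticAt.frequently_eq_iff_eventually_eq hu hv).1 ?_
  have ht : Tendsto (fun s : ℝ => (s : ℂ)) (𝓝[>] x₀) (𝓝[≠] (x₀ : ℂ)) := by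
    refine tendsto_nhdsWithin_iff.2 ⟨?_, ?_⟩
    · exact (Complex.continuous_ofReal.tendsto x₀).mono_left nhdsWithin_le_nhds
    · filter_upwards [self_mem_nhdsWithin] with s hs
      exact fun h => (ne_of_gt hs) (Complex.ofReal_injective h)
  exact ht.frequently h.frequently

/-- Local uniqueness.  The difference of two solutions satisfies a linear equation with bounded
coefficients, so it vanishes to the right of `x₀` by a Grönwall argument. -/
theorem SolvesOn.eventuallyEq {u v : ℂ → ℂ} {S : Set ℂ} (hS : IsOpen S) (hu : SolvesOn u S)
    (hv : SolvesOn v S) {x₀ : ℝ} (hx : (x₀ : ℂ) ∈ S) (h0 : u x₀ = v x₀)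
    (h1 : deriv u x₀ = deriv v x₀) : u =ᶠ[𝓝 (x₀ : ℂ)] v := by
  obtain ⟨δ, hδ, hball⟩ := Metric.nhds_basis_closedBall.mem_iff.1 (hS.mem_nhds hx)
  have hcont : ContinuousOn (fun x => 6 * (u x + v x)) (Metric.closedBall (x₀ : ℂ) δ) :=
    (continuousOn_const.mul (hu.1.continuousOn.add hv.1.continuousOn)).mono hball
  obtain ⟨M, hM⟩ := (isCompact_closedBall (x₀ : ℂ) δ).exists_bound_of_continuousOn hcont
  have hmem : ∀ s ∈ Set.Icc x₀ (x₀ + δ), (s : ℂ) ∈ Metric.closedBall (x₀ : ℂ) δ := by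
    intro s hs
    rw [mem_closedBall_iff_norm, ← Complex.ofReal_sub, Complex.norm_real,
      Real.norm_of_nonneg (by linarith [hs.1])]
    linarith [hs.2]
  have hder : ∀ s ∈ Set.Icc x₀ (x₀ + δ), HasDerivAt
      (fun s : ℝ => (u s - v s, deriv u s - deriv v s))
      (deriv u s - deriv v s, 6 * (u s + v s) * (u s - v s)) s := by
    intro s hs
    have hsS := hball (hmem s hs)
    have d1 := ((hu.hasDerivAt hS hsS).sub (hv.hasDerivAt hS hsS)).comp_ofReal
    have d2 := ((hu.hasDerivAt_deriv hS hsS).sub (hv.hasDerivAt_deriv hS hsS)).comp_ofReal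
    have e : 6 * u s ^ 2 - (s : ℂ) - (6 * v s ^ 2 - s) = 6 * (u s + v s) * (u s - v s) := by ring
    rw [e] at d2
    exact d1.prodMk d2
  have hz := eq_zero_of_abs_deriv_le_mul_abs_self_of_eq_zero_right (K := max 1 M)
    (f := fun s : ℝ => (u s - v s, deriv u s - deriv v s))
    (f' := fun s : ℝ => (deriv u s - deriv v s, 6 * (u s + v s) * (u s - v s)))
    (a := x₀) (b := x₀ + δ)
    (fun s hs => (hder s hs).continuousAt.continuousWithinAt)
    (fun s hs => (hder s ⟨hs.1, hs.2.le⟩).hasDerivWithinAt)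
    (by simp [h0, h1]) (by
      intro s hs
      have hm := hM _ (hmem s ⟨hs.1, hs.2.le⟩)
      rw [Prod.norm_def, Prod.norm_def]
      refine max_le ?_ ?_
      · calc ‖deriv u s - deriv v s‖ = 1 * ‖deriv u s - deriv v s‖ := (one_mul _).symm
          _ ≤ _ := by gcongr <;> simp
      · dsimp only
        rw [norm_mul]
        gcongr
        · exact hm.trans (le_max_right _ _)
        · simp)
  refine eventuallyEq_of_eq_right (hu.1.analyticAt (hS.mem_nhds hx))
    (hv.1.analyticAt (hS.mem_nhds hx)) ?_
  filter_upwards [Ioo_mem_nhdsGT (show x₀ < x₀ + δ by linarith)] with s hs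
  have := congrArg Prod.fst (hz s ⟨hs.1.le, hs.2.le⟩)
  exact sub_eq_zero.1 this

theorem SolvesOn.eqOn {u v : ℂ → ℂ} {S : Set ℂ} (hS : IsOpen S) (hc : IsPreconnected S)
    (hu : SolvesOn u S) (hv : SolvesOn v S) {x₀ : ℝ} (hx : (x₀ : ℂ) ∈ S) (h0 : u x₀ = v x₀)
    (h1 : deriv u x₀ = deriv v x₀) : Set.EqOn u v S :=
  (hu.1.analyticOnNhd hS).eqOn_of_preconnected_of_eventuallyEq (hv.1.analyticOnNhd hS) hc hx
    (hu.eventuallyEq hS hv hx h0 h1)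

/-! ### An explicit approximate solution on the half-line -/

/-- The variable `τ = (1 + 2x/3)^(-1/2)`, which maps `[0, ∞)` onto `(0, 1]` and satisfies
`dτ/dx = -τ³/3`. -/
def tau (x : ℝ) : ℝ := 1 / √(1 + 2 * x / 3)

/-- The approximate solution, as a function of `τ`.  The first three terms are the expansion of
`-√(x/6)`; the remaining coefficients make the residual uniformly small relative to `τ³`. -/
def approx (t : ℝ) : ℝ :=
  -(1 / 2) * t⁻¹ + 1 / 4 * t + 1 / 16 * t ^ 3 - 19 / 2000 * t ^ 4 + 139 / 4000 * t ^ 5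
    - 73 / 4000 * t ^ 6 - 27 / 4000 * t ^ 7

/-- The `x`-derivative of the approximate solution, as a function of `τ`. -/
def approxDeriv (t : ℝ) : ℝ :=
  -(1 / 6) * t - 1 / 12 * t ^ 3 - 1 / 16 * t ^ 5 + 19 / 1500 * t ^ 6 - 139 / 2400 * t ^ 7
    + 73 / 2000 * t ^ 8 + 63 / 4000 * t ^ 9

/-- The second `x`-derivative of the approximate solution, as a function of `τ`. -/
def approxDeriv2 (t : ℝ) : ℝ :=
  1 / 18 * t ^ 3 + 1 / 12 * t ^ 5 + 5 / 48 * t ^ 7 - 19 / 750 * t ^ 8 + 973 / 7200 * t ^ 9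
    - 73 / 750 * t ^ 10 - 189 / 4000 * t ^ 11

/-- The residual `g₀'' - 6 g₀² + x` of the approximate solution, divided by `τ³`. -/
def approxResidual (t : ℝ) : ℝ :=
  -13 / 9000 + 21 / 1000 * t + 7 / 3000 * t ^ 2 - 2691 / 16000 * t ^ 3 + 797 / 4800 * t ^ 4
    - 47531 / 1500000 * t ^ 5 + 1375091 / 9000000 * t ^ 6 - 2438321 / 24000000 * t ^ 7
    - 161637 / 4000000 * t ^ 8 + 6531 / 8000000 * t ^ 9 - 5913 / 4000000 * t ^ 10
    - 2187 / 8000000 * t ^ 11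

theorem tau_pos {x : ℝ} (hx : 0 ≤ x) : 0 < tau x := by unfold tau; positivity

theorem tau_le_one {x : ℝ} (hx : 0 ≤ x) : tau x ≤ 1 := by
  unfold tau
  rw [div_le_one (by positivity)]
  exact Real.one_le_sqrt.2 (by linarith)

theorem tau_zero : tau 0 = 1 := by simp [tau]

theorem eq_of_tau {x : ℝ} (hx : 0 ≤ x) : x = 3 / 2 * ((tau x)⁻¹ ^ 2 - 1) := by
  unfold tau
  rw [one_div, inv_inv, Real.sq_sqrt (by positivity)]
  ring

theorem hasDerivAt_tau {x : ℝ} (hx : 0 ≤ x) : HasDerivAt tau (-(tau x) ^ 3 / 3) x := by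
  have h1 : HasDerivAt (fun x : ℝ => 1 + 2 * x / 3) (2 / 3) x := by
    have := (((hasDerivAt_id x).const_mul 2).div_const 3).const_add 1
    simpa using this
  have h2 := (h1.sqrt (by positivity)).inv (by positivity)
  have h3 : tau = (fun x : ℝ => √(1 + 2 * x / 3))⁻¹ := by
    funext x; simp [tau]
  rw [← h3] at h2
  refine h2.congr_deriv ?_
  unfold tau
  have : √(1 + 2 * x / 3) ≠ 0 := by positivity
  field_simp

theorem hasDerivAt_approx {x : ℝ} (hx : 0 ≤ x) :
    HasDerivAt (fun x => approx (tau x)) (approxDeriv (tau x)) x := by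
  have ht := hasDerivAt_tau hx
  have hp := (tau_pos hx).ne'
  have h := (((((((ht.inv hp).const_mul (-(1 / 2))).add (ht.const_mul (1 / 4))).add
    ((ht.pow 3).const_mul (1 / 16))).sub ((ht.pow 4).const_mul (19 / 2000))).add
    ((ht.pow 5).const_mul (139 / 4000))).sub ((ht.pow 6).const_mul (73 / 4000))).sub
    ((ht.pow 7).const_mul (27 / 4000))
  refine h.congr_deriv ?_
  unfold approxDeriv
  field_simp
  ring

theorem hasDerivAt_approxDeriv {x : ℝ} (hx : 0 ≤ x) :
    HasDerivAt (fun x => approxDeriv (tau x)) (approxDeriv2 (tau x)) x := by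
  have ht := hasDerivAt_tau hx
  have h := ((((((ht.const_mul (-(1 / 6))).sub ((ht.pow 3).const_mul (1 / 12))).sub
    ((ht.pow 5).const_mul (1 / 16))).add ((ht.pow 6).const_mul (19 / 1500))).sub
    ((ht.pow 7).const_mul (139 / 2400))).add ((ht.pow 8).const_mul (73 / 2000))).add
    ((ht.pow 9).const_mul (63 / 4000))
  refine h.congr_deriv ?_
  unfold approxDeriv2
  ring

theorem approxDeriv2_sub {x : ℝ} (hx : 0 ≤ x) :
    approxDeriv2 (tau x) - 6 * approx (tau x) ^ 2 + x = tau x ^ 3 * approxResidual (tau x) := by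
  have hp := (tau_pos hx).ne'
  have e := eq_of_tau hx
  generalize tau x = t at hp e
  rw [e]
  unfold approxDeriv2 approx approxResidual
  field_simp
  ring

theorem approx_le {t : ℝ} (h0 : 0 < t) (h1 : t ≤ 1) : approx t ≤ -(3 / 20) * t⁻¹ := by
  have e : approx t + 3 / 20 * t⁻¹ = -t⁻¹ * (7 / 20 - 1 / 4 * t ^ 2 - 1 / 16 * t ^ 4
      + 19 / 2000 * t ^ 5 - 139 / 4000 * t ^ 6 + 73 / 4000 * t ^ 7 + 27 / 4000 * t ^ 8) := by
    unfold approx; field_simp; ring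
  have h2 : t ^ 2 ≤ 1 := pow_le_one₀ h0.le h1
  have h4 : t ^ 4 ≤ 1 := pow_le_one₀ h0.le h1
  have h6 : t ^ 6 ≤ 1 := pow_le_one₀ h0.le h1
  have h5 : 0 ≤ t ^ 5 := by positivity
  have h7 : 0 ≤ t ^ 7 := by positivity
  have h8 : 0 ≤ t ^ 8 := by positivity
  have : 0 ≤ t⁻¹ * (7 / 20 - 1 / 4 * t ^ 2 - 1 / 16 * t ^ 4
      + 19 / 2000 * t ^ 5 - 139 / 4000 * t ^ 6 + 73 / 4000 * t ^ 7 + 27 / 4000 * t ^ 8) :=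
    mul_nonneg (by positivity) (by linarith)
  linarith

theorem approxDeriv_nonpos {t : ℝ} (h0 : 0 < t) (h1 : t ≤ 1) : approxDeriv t ≤ 0 := by
  have h6 : t ^ 6 ≤ t := by simpa using pow_le_pow_of_le_one h0.le h1 (show 1 ≤ 6 by norm_num)
  have h8 : t ^ 8 ≤ t := by simpa using pow_le_pow_of_le_one h0.le h1 (show 1 ≤ 8 by norm_num)
  have h9 : t ^ 9 ≤ t := by simpa using pow_le_pow_of_le_one h0.le h1 (show 1 ≤ 9 by norm_num)
  have h3 : 0 ≤ t ^ 3 := by positivity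
  have h5 : 0 ≤ t ^ 5 := by positivity
  have h7 : 0 ≤ t ^ 7 := by positivity
  unfold approxDeriv
  linarith

/-- The two bounds are proved by expanding `29/10000 ± approxResidual` in a Bernstein basis on a
few subintervals of `[0, 1]`, where all the coefficients are positive. -/
theorem abs_approxResidual_le {t : ℝ} (h0 : 0 ≤ t) (h1 : t ≤ 1) :
    |approxResidual t| ≤ 29 / 10000 := by
  unfold approxResidual
  rw [abs_le]
  constructor
  · rcases le_total t (1 / 2) with h2 | h2
    · have key : ∀ X Y : ℝ, 0 ≤ X → 0 ≤ Y →
          0 ≤ 214630400 * Y ^ 11 + 3909222400 * X * Y ^ 10 + 27373568000 * X ^ 2 * Y ^ 9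
          + 102761088000 * X ^ 3 * Y ^ 8 + 236449152000 * X ^ 4 * Y ^ 7
          + 355289837568 * X ^ 5 * Y ^ 6 + 358175016704 * X ^ 6 * Y ^ 5
          + 242815536592 * X ^ 7 * Y ^ 4 + 108499022960 * X ^ 8 * Y ^ 3
          + 30466527964 * X ^ 9 * Y ^ 2 + 4875680036 * X ^ 10 * Y + 344837893 * X ^ 11 := by
        intro X Y hX hY; positivity
      have := key t (1 / 2 - t) (by linarith) (by linarith)
      linear_combination (1 / 72000000) * this
    · have key : ∀ X Y : ℝ, 0 ≤ X → 0 ≤ Y →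
          0 ≤ 344837893 * Y ^ 11 + 2710753610 * X * Y ^ 10 + 8817263704 * X ^ 2 * Y ^ 9
          + 17462092672 * X ^ 3 * Y ^ 8 + 34102436528 * X ^ 4 * Y ^ 7
          + 78657205024 * X ^ 5 * Y ^ 6 + 145335810112 * X ^ 6 * Y ^ 5
          + 173246419328 * X ^ 7 * Y ^ 4 + 124771631104 * X ^ 8 * Y ^ 3
          + 49949664256 * X ^ 9 * Y ^ 2 + 8772494336 * X ^ 10 * Y + 118319104 * X ^ 11 := by
        intro X Y hX hY; positivity
      have := key (t - 1 / 2) (1 - t) (by linarith) (by linarith)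
      linear_combination (1 / 72000000) * this
  · rcases le_total t (1 / 2) with h2 | h2
    · have key : ∀ X Y : ℝ, 0 ≤ X → 0 ≤ Y →
          0 ≤ 640614400 * Y ^ 11 + 5498470400 * X * Y ^ 10 + 19664896000 * X ^ 2 * Y ^ 9
          + 38354304000 * X ^ 3 * Y ^ 8 + 45781632000 * X ^ 4 * Y ^ 7
          + 39833260032 * X ^ 5 * Y ^ 6 + 36948080896 * X ^ 6 * Y ^ 5
          + 39415247408 * X ^ 7 * Y ^ 4 + 32616369040 * X ^ 8 * Y ^ 3
          + 16571936036 * X ^ 9 * Y ^ 2 + 4532012764 * X ^ 10 * Y + 510406907 * X ^ 11 := by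
        intro X Y hX hY; positivity
      have := key t (1 / 2 - t) (by linarith) (by linarith)
      linear_combination (1 / 72000000) * this
    · rcases le_total t (3 / 4) with h3 | h3
      · have key : ∀ X Y : ℝ, 0 ≤ X → 0 ≤ Y →
            0 ≤ 1045313345536 * Y ^ 11 + 12606889131008 * X * Y ^ 10
            + 68230641705472 * X ^ 2 * Y ^ 9
            + 218425217330432 * X ^ 3 * Y ^ 8 + 458929271662336 * X ^ 4 * Y ^ 7
            + 663577776119168 * X ^ 5 * Y ^ 6 + 672741459405888 * X ^ 6 * Y ^ 5
            + 477372720827808 * X ^ 7 * Y ^ 4 + 231895836297528 * X ^ 8 * Y ^ 3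
            + 73293092264684 * X ^ 9 * Y ^ 2 + 13540425659386 * X ^ 10 * Y
            + 1107252422729 * X ^ 11 := by
          intro X Y hX hY; positivity
        have := key (t - 1 / 2) (3 / 4 - t) (by linarith) (by linarith)
        linear_combination (1 / 72000000) * this
      · have key : ∀ X Y : ℝ, 0 ≤ X → 0 ≤ Y →
            0 ≤ 1107252422729 * Y ^ 11 + 10819127640652 * X * Y ^ 10
            + 46080112077344 * X ^ 2 * Y ^ 9
            + 111676403779584 * X ^ 3 * Y ^ 8 + 168728785180416 * X ^ 4 * Y ^ 7
            + 164890570816512 * X ^ 5 * Y ^ 6 + 108775275057152 * X ^ 6 * Y ^ 5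
            + 58155588861952 * X ^ 7 * Y ^ 4 + 35921825103872 * X ^ 8 * Y ^ 3
            + 22513509203968 * X ^ 9 * Y ^ 2 + 8951174266880 * X ^ 10 * Y
            + 1509223825408 * X ^ 11 := by
          intro X Y hX hY; positivity
        have := key (t - 3 / 4) (1 - t) (by linarith) (by linarith)
        linear_combination (1 / 72000000) * this

/-! ### The energy estimate -/

/-- The energy of the deviation `(w, w') = (u - g₀, u' - g₀')` from the approximate solution:
`|w'|² + q |w|²` with `q = -12 g₀ > 0`. -/
def energy (u v : ℝ → ℂ) (x : ℝ) : ℝ :=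
  ‖v x - approxDeriv (tau x)‖ ^ 2 + -12 * approx (tau x) * ‖u x - approx (tau x)‖ ^ 2

theorem neg_twelve_approx_ge {x : ℝ} (hx : 0 ≤ x) :
    9 / 5 * (tau x)⁻¹ ≤ -12 * approx (tau x) := by
  have := approx_le (tau_pos hx) (tau_le_one hx)
  linarith

theorem hasDerivAt_energy {u v : ℝ → ℂ} {x : ℝ} (hx : 0 ≤ x) (hu : HasDerivAt u (v x) x)
    (hv : HasDerivAt v (6 * u x ^ 2 - x) x) :
    HasDerivAt (energy u v)
      (2 * inner ℝ (v x - approxDeriv (tau x)) (6 * (u x - approx (tau x)) ^ 2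
        - ((tau x ^ 3 * approxResidual (tau x) : ℝ) : ℂ))
        + -12 * approxDeriv (tau x) * ‖u x - approx (tau x)‖ ^ 2) x := by
  have d0 := hasDerivAt_approx hx
  have dw := hu.sub d0.ofReal_comp
  have dw' := hv.sub (hasDerivAt_approxDeriv hx).ofReal_comp
  have h := dw'.norm_sq.add ((d0.const_mul (-12)).mul dw.norm_sq)
  refine h.congr_deriv ?_
  have hr := approxDeriv2_sub hx
  simp only [Pi.sub_apply]
  generalize tau x = t at hr ⊢
  have e : (6 * u x ^ 2 - x - (approxDeriv2 t : ℂ)) =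
      (6 * (u x - approx t) ^ 2 - ((t ^ 3 * approxResidual t : ℝ) : ℂ)) +
        (12 * approx t) • (u x - approx t) := by
    rw [← hr, Complex.real_smul]; push_cast; ring
  rw [e, inner_add_right, inner_smul_right, real_inner_comm (v x - _) (u x - _)]
  ring

/-- Where the energy equals `(98/10000 τ)²` it decreases more slowly in `x` than this bound:
this is the differential inequality behind `energy_le`. -/
theorem lt_deriv_energy {u v : ℝ → ℂ} {x : ℝ} (hx : 0 ≤ x)
    (hE : energy u v x = (98 / 10000 * tau x) ^ 2) :
    2 * (98 / 10000 * tau x) * (98 / 10000 * (-(tau x) ^ 3 / 3)) <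
      2 * inner ℝ (v x - approxDeriv (tau x)) (6 * (u x - approx (tau x)) ^ 2
        - ((tau x ^ 3 * approxResidual (tau x) : ℝ) : ℂ))
        + -12 * approxDeriv (tau x) * ‖u x - approx (tau x)‖ ^ 2 := by
  have ht := tau_pos hx
  have ht1 := tau_le_one hx
  have hq := neg_twelve_approx_ge hx
  have hd := approxDeriv_nonpos ht ht1
  have hres := abs_approxResidual_le ht.le ht1
  unfold energy at hE
  generalize tau x = t at *
  set w' := v x - (approxDeriv t : ℂ) with hw'
  set w := u x - (approx t : ℂ) with hw
  have hti : 0 < t⁻¹ := inv_pos.2 ht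
  have h1 : 0 ≤ -12 * approxDeriv t * ‖w‖ ^ 2 :=
    mul_nonneg (by linarith) (sq_nonneg _)
  have hw2 : ‖w‖ ^ 2 ≤ (5 / 9) * (98 / 10000) ^ 2 * t ^ 3 := by
    have h2 : 9 / 5 * t⁻¹ * ‖w‖ ^ 2 ≤ (98 / 10000 * t) ^ 2 := by
      nlinarith [sq_nonneg ‖w'‖, mul_le_mul_of_nonneg_right hq (sq_nonneg ‖w‖)]
    have h3 : ‖w‖ ^ 2 = (5 / 9) * t * (9 / 5 * t⁻¹ * ‖w‖ ^ 2) := by field_simp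
    rw [h3]
    calc (5 / 9) * t * (9 / 5 * t⁻¹ * ‖w‖ ^ 2) ≤ (5 / 9) * t * (98 / 10000 * t) ^ 2 := by gcongr
      _ = _ := by ring
  have hw'2 : ‖w'‖ ≤ 98 / 10000 * t := by
    refine le_of_sq_le_sq ?_ (by positivity)
    have : 0 ≤ -12 * approx t * ‖w‖ ^ 2 :=
      mul_nonneg (by linarith) (sq_nonneg _)
    linarith
  have hF : ‖6 * w ^ 2 - ((t ^ 3 * approxResidual t : ℝ) : ℂ)‖ ≤
      6 * ((5 / 9) * (98 / 10000) ^ 2 * t ^ 3) + t ^ 3 * (29 / 10000) := by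
    refine (norm_sub_le _ _).trans (add_le_add ?_ ?_)
    · rw [norm_mul, norm_pow]
      have : ‖(6 : ℂ)‖ = 6 := by simp
      rw [this]; gcongr
    · rw [Complex.norm_real, Real.norm_eq_abs, abs_mul, abs_of_pos (by positivity)]
      gcongr
  have hin := (abs_le.1 ((abs_real_inner_le_norm w' (6 * w ^ 2 -
    ((t ^ 3 * approxResidual t : ℝ) : ℂ))).trans (mul_le_mul hw'2 hF (norm_nonneg _)
    (by positivity)))).1
  have ht4 : 0 < t ^ 4 := by positivity
  -- after division by `2 β t⁴`, where `β = 98/10000`, this is `(10/3) β² + 29/10000 < β / 3`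
  nlinarith

/-- If the energy is below `(98/10000 τ)²` near infinity, it is so on the whole half-line on which
the solution exists: going down from infinity, it cannot cross this barrier. -/
theorem energy_le {u v : ℝ → ℂ} {x₀ : ℝ} (hx₀ : 0 ≤ x₀)
    (hu : ∀ x, x₀ ≤ x → HasDerivAt u (v x) x)
    (hv : ∀ x, x₀ ≤ x → HasDerivAt v (6 * u x ^ 2 - x) x)
    (hinf : ∀ᶠ x in atTop, energy u v x ≤ (98 / 10000 * tau x) ^ 2) {x : ℝ} (hx : x₀ ≤ x) :
    energy u v x ≤ (98 / 10000 * tau x) ^ 2 := by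
  obtain ⟨X, hX, hxX⟩ := (hinf.and (eventually_ge_atTop x)).exists
  have hdE : ∀ s, s ∈ Set.Icc (-X) (-x) → HasDerivAt (fun s => energy u v (-s)) _ s := fun s hs =>
    ((hasDerivAt_energy (by linarith [hs.2]) (hu _ (by linarith [hs.2]))
      (hv _ (by linarith [hs.2])))).comp s (hasDerivAt_neg s)
  have hdB : ∀ s, s ∈ Set.Icc (-X) (-x) →
      HasDerivAt (fun s => (98 / 10000 * tau (-s)) ^ 2) _ s := fun s hs =>
    (((hasDerivAt_tau (by linarith [hs.2])).const_mul (98 / 10000)).pow 2).comp s (hasDerivAt_neg s)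
  have := image_le_of_deriv_right_lt_deriv_boundary'
    (fun s hs => (hdE s hs).continuousAt.continuousWithinAt)
    (fun s hs => (hdE s ⟨hs.1, hs.2.le⟩).hasDerivWithinAt)
    (by simpa using hX)
    (fun s hs => (hdB s hs).continuousAt.continuousWithinAt)
    (fun s hs => (hdB s ⟨hs.1, hs.2.le⟩).hasDerivWithinAt)
    (fun s hs hs' => by
      have := lt_deriv_energy (by linarith [hs.2]) hs'
      rw [mul_neg_one, mul_neg_one, neg_lt_neg_iff]
      refine lt_of_eq_of_lt ?_ this
      push_cast
      ring)
    (Set.right_mem_Icc.2 (neg_le_neg hxX))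
  simpa using this

theorem norm_sub_approx_le_of_energy_le {u v : ℝ → ℂ} {x : ℝ} (hx : 0 ≤ x)
    (h : energy u v x ≤ (98 / 10000 * tau x) ^ 2) :
    ‖u x - approx (tau x)‖ ≤ 98 / 10000 ∧ ‖v x - approxDeriv (tau x)‖ ≤ 98 / 10000 := by
  have ht := tau_pos hx
  have ht1 := tau_le_one hx
  have hq := neg_twelve_approx_ge hx
  have hti : 1 ≤ (tau x)⁻¹ := (one_le_inv₀ ht).2 ht1
  have h2 : (98 / 10000 * tau x) ^ 2 ≤ (98 / 10000) ^ 2 := by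
    refine pow_le_pow_left₀ (by positivity) (by linarith) 2
  unfold energy at h
  constructor
  · refine le_of_sq_le_sq ?_ (by positivity)
    nlinarith [sq_nonneg ‖v x - approxDeriv (tau x)‖, sq_nonneg ‖u x - approx (tau x)‖]
  · refine le_of_sq_le_sq ?_ (by positivity)
    nlinarith [sq_nonneg ‖v x - approxDeriv (tau x)‖, sq_nonneg ‖u x - approx (tau x)‖]

/-! ### Behaviour at infinity -/

/-- `u = -√(x/6) + O(x⁻²)` on the half-line, in the form in which it is used: together with the
corresponding estimate for the derivative `v`. -/
def HasTritronqueeAsymptotics (u v : ℝ → ℂ) : Prop :=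
  ∃ C : ℝ, ∀ᶠ x : ℝ in atTop, ‖u x + (√(x / 6) : ℝ)‖ ≤ C / x ^ 2 ∧
    ‖v x + (√(x / 6) / (2 * x) : ℝ)‖ ≤ C / x ^ 2

theorem tendsto_tau : Tendsto tau atTop (𝓝 0) := by
  have h1 : Tendsto (fun x : ℝ => 1 + 2 * x / 3) atTop atTop :=
    tendsto_atTop_add_const_left _ _
      ((tendsto_id.const_mul_atTop two_pos).atTop_div_const three_pos)
  have h2 := (Real.tendsto_sqrt_atTop.comp h1).inv_tendsto_atTop
  refine h2.congr fun x => ?_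
  simp [tau]

/-- `approx` follows `-√(x/6) = -√(1 - τ²) / (2τ)` up to `O(τ³)`. -/
theorem abs_sqrt_add_approx_le {x : ℝ} (hx : 0 ≤ x) :
    |√(x / 6) + approx (tau x)| ≤ 2 * tau x ^ 3 := by
  have ht := tau_pos hx
  have ht1 := tau_le_one hx
  have e := eq_of_tau hx
  generalize tau x = t at *
  have ht2 : t ^ 2 ≤ 1 := pow_le_one₀ ht.le ht1
  have hs : √(x / 6) = √(1 - t ^ 2) * (1 / 2 * t⁻¹) := by
    rw [← Real.sqrt_sq (show 0 ≤ 1 / 2 * t⁻¹ by positivity), ← Real.sqrt_mul (by linarith), e]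
    congr 1
    field_simp
    ring
  set s := √(1 - t ^ 2) with hsdef
  have hs0 : 0 ≤ s := Real.sqrt_nonneg _
  have hs2 : s ^ 2 = 1 - t ^ 2 := Real.sq_sqrt (by linarith)
  have hup : s ≤ 1 - t ^ 2 / 2 := by
    refine le_of_sq_le_sq ?_ (by linarith)
    nlinarith [sq_nonneg (t ^ 2)]
  have hlo : 1 - t ^ 2 / 2 - t ^ 4 ≤ s := by
    by_contra! hc
    have hA : 1 - t ^ 2 / 2 + s ≥ 1 / 2 := by linarith
    have hB : (1 - t ^ 2 / 2 - s) * (1 - t ^ 2 / 2 + s) = t ^ 4 / 4 := by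
      linear_combination -hs2
    have hC : t ^ 4 < 1 - t ^ 2 / 2 - s := by linarith
    have ht4 : 0 < t ^ 4 := by positivity
    nlinarith
  have hsplit : √(x / 6) + approx t = (s - 1 + t ^ 2 / 2) * (1 / 2 * t⁻¹) +
      t ^ 3 * (1 / 16 - 19 / 2000 * t + 139 / 4000 * t ^ 2 - 73 / 4000 * t ^ 3
        - 27 / 4000 * t ^ 4) := by
    rw [hs]; unfold approx; field_simp; ring
  have h1 : |(s - 1 + t ^ 2 / 2) * (1 / 2 * t⁻¹)| ≤ t ^ 3 := by
    rw [abs_mul, abs_of_pos (show 0 < 1 / 2 * t⁻¹ by positivity)]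
    have : |s - 1 + t ^ 2 / 2| ≤ t ^ 4 := abs_le.2 ⟨by linarith, by linarith [pow_pos ht 4]⟩
    calc _ ≤ t ^ 4 * (1 / 2 * t⁻¹) := by gcongr
      _ = 1 / 2 * t ^ 3 := by field_simp
      _ ≤ _ := by linarith [pow_pos ht 3]
  have h3 : t ^ 3 ≤ 1 := pow_le_one₀ ht.le ht1
  have h4 : t ^ 4 ≤ 1 := pow_le_one₀ ht.le ht1
  have h2 : |t ^ 3 * (1 / 16 - 19 / 2000 * t + 139 / 4000 * t ^ 2 - 73 / 4000 * t ^ 3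
      - 27 / 4000 * t ^ 4)| ≤ t ^ 3 := by
    rw [abs_mul, abs_of_pos (pow_pos ht 3)]
    refine mul_le_of_le_one_right (by positivity) (abs_le.2 ⟨?_, ?_⟩)
    · linarith [sq_nonneg t]
    · linarith [pow_pos ht 3, pow_pos ht 4]
  rw [hsplit]
  refine (abs_add_le _ _).trans ?_
  linarith

theorem abs_sqrt_div_add_approxDeriv_le {x : ℝ} (hx : 0 < x) (hx1 : tau x ≤ 1 / 2) :
    |√(x / 6) / (2 * x) + approxDeriv (tau x)| ≤ 2 * tau x ^ 3 := by
  have ht := tau_pos hx.le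
  have e := eq_of_tau hx.le
  generalize tau x = t at *
  have ht1 : t ≤ 1 := by linarith
  have ht2 : t ^ 2 ≤ 1 / 4 := by nlinarith
  have hs : √(x / 6) = √(1 - t ^ 2) * (1 / 2 * t⁻¹) := by
    rw [← Real.sqrt_sq (show 0 ≤ 1 / 2 * t⁻¹ by positivity), ← Real.sqrt_mul (by linarith), e]
    congr 1
    field_simp
    ring
  set s := √(1 - t ^ 2) with hsdef
  have hs0 : 0 ≤ s := Real.sqrt_nonneg _
  have hs2 : s ^ 2 = 1 - t ^ 2 := Real.sq_sqrt (by linarith)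
  have hs1 : 1 / 2 ≤ s := le_of_sq_le_sq (by rw [hs2]; linarith) hs0
  have hsl : s ≤ 1 := le_of_sq_le_sq (by rw [hs2]; linarith [sq_nonneg t]) (by norm_num)
  have hx2 : x = 3 / 2 * (s ^ 2 / t ^ 2) := by rw [hs2, e]; field_simp
  have hq : √(x / 6) / (2 * x) = t / (6 * s) := by
    rw [hs, hx2]; field_simp; ring
  have h1 : |t / (6 * s) - t / 6| ≤ t ^ 3 := by
    have : t / (6 * s) - t / 6 = t * (1 - s) / (6 * s) := by field_simp
    rw [this, abs_of_nonneg (div_nonneg (mul_nonneg ht.le (by linarith)) (by linarith)),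
      div_le_iff₀ (by linarith)]
    have : 1 - s ≤ t ^ 2 := by nlinarith
    calc t * (1 - s) ≤ t * t ^ 2 := by gcongr
      _ = t ^ 3 * 1 := by ring
      _ ≤ _ := by gcongr; linarith
  have h3 : t ^ 3 ≤ 1 := pow_le_one₀ ht.le ht1
  have h4 : t ^ 4 ≤ 1 := pow_le_one₀ ht.le ht1
  have h5 : t ^ 5 ≤ 1 := pow_le_one₀ ht.le ht1
  have h6 : t ^ 6 ≤ 1 := pow_le_one₀ ht.le ht1
  have h2 : |t ^ 3 * (-(1 / 12) - 1 / 16 * t ^ 2 + 19 / 1500 * t ^ 3 - 139 / 2400 * t ^ 4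
      + 73 / 2000 * t ^ 5 + 63 / 4000 * t ^ 6)| ≤ t ^ 3 := by
    rw [abs_mul, abs_of_pos (pow_pos ht 3)]
    refine mul_le_of_le_one_right (by positivity) (abs_le.2 ⟨?_, ?_⟩)
    · linarith [pow_pos ht 3, pow_pos ht 5, pow_pos ht 6]
    · linarith [pow_pos ht 2, pow_pos ht 4]
  have hsplit : √(x / 6) / (2 * x) + approxDeriv t = (t / (6 * s) - t / 6) +
      t ^ 3 * (-(1 / 12) - 1 / 16 * t ^ 2 + 19 / 1500 * t ^ 3 - 139 / 2400 * t ^ 4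
      + 73 / 2000 * t ^ 5 + 63 / 4000 * t ^ 6) := by
    rw [hq]; unfold approxDeriv; ring
  rw [hsplit]
  refine (abs_add_le _ _).trans ?_
  linarith

theorem neg_approx_le {t : ℝ} (h0 : 0 < t) (h1 : t ≤ 1) : -12 * approx t ≤ 12 * t⁻¹ := by
  have e : t⁻¹ + approx t = 1 / 2 * t⁻¹ + (1 / 4 * t + 1 / 16 * t ^ 3
      + 139 / 4000 * t ^ 5) - 19 / 2000 * t ^ 4 - 73 / 4000 * t ^ 6 - 27 / 4000 * t ^ 7 := by
    unfold approx; ring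
  have h4 : t ^ 4 ≤ 1 := pow_le_one₀ h0.le h1
  have h6 : t ^ 6 ≤ 1 := pow_le_one₀ h0.le h1
  have h7 : t ^ 7 ≤ 1 := pow_le_one₀ h0.le h1
  have hi : 1 ≤ t⁻¹ := (one_le_inv₀ h0).2 h1
  have : 0 ≤ 1 / 4 * t + 1 / 16 * t ^ 3 + 139 / 4000 * t ^ 5 := by positivity
  linarith

theorem HasTritronqueeAsymptotics.eventually_energy_le {u v : ℝ → ℂ}
    (h : HasTritronqueeAsymptotics u v) :
    ∀ᶠ x in atTop, energy u v x ≤ (98 / 10000 * tau x) ^ 2 := by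
  obtain ⟨C, hC⟩ := h
  set K := |C| + 2 with hK
  have hKpos : 0 < K := by positivity
  have hsmall : ∀ᶠ x in atTop, tau x < min (1 / 2) ((98 / 10000) ^ 2 / (13 * K ^ 2)) :=
    tendsto_tau.eventually_lt_const (by positivity)
  filter_upwards [hC, hsmall, eventually_gt_atTop 0] with x ⟨hu, hv⟩ hτ hx
  have ht := tau_pos hx.le
  have hτ1 : tau x ≤ 1 / 2 := (hτ.le.trans (min_le_left _ _))
  have hτ2 : tau x ≤ (98 / 10000) ^ 2 / (13 * K ^ 2) := (hτ.le.trans (min_le_right _ _))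
  have ha := abs_sqrt_add_approx_le hx.le
  have hb := abs_sqrt_div_add_approxDeriv_le hx hτ1
  have e := eq_of_tau hx.le
  have hqu := neg_approx_le ht (by linarith)
  have hq0 := neg_twelve_approx_ge hx.le
  unfold energy
  generalize tau x = t at *
  have hxt : t⁻¹ ^ 2 ≤ x := by
    have : 2 ≤ t⁻¹ := by rw [le_inv_comm₀ (by norm_num) ht]; linarith
    nlinarith
  have hCx : C / x ^ 2 ≤ |C| * t ^ 3 := by
    calc C / x ^ 2 ≤ |C| / (t⁻¹ ^ 2) ^ 2 := by gcongr; exact le_abs_self C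
      _ = |C| * t ^ 3 * t := by field_simp
      _ ≤ |C| * t ^ 3 * 1 := by gcongr; linarith
      _ = _ := mul_one _
  have hw : ‖u x - approx t‖ ≤ K * t ^ 3 := by
    have : u x - (approx t : ℂ) = (u x + (√(x / 6) : ℝ)) - ((√(x / 6) + approx t : ℝ) : ℂ) := by
      push_cast; ring
    rw [this]
    refine (norm_sub_le _ _).trans ?_
    rw [Complex.norm_real, Real.norm_eq_abs, hK]
    linarith
  have hw' : ‖v x - approxDeriv t‖ ≤ K * t ^ 3 := by
    have : v x - (approxDeriv t : ℂ) = (v x + (√(x / 6) / (2 * x) : ℝ)) -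
        ((√(x / 6) / (2 * x) + approxDeriv t : ℝ) : ℂ) := by
      push_cast; ring
    rw [this]
    refine (norm_sub_le _ _).trans ?_
    rw [Complex.norm_real, Real.norm_eq_abs, hK]
    linarith
  have hq00 : 0 ≤ -12 * approx t := by linarith [inv_pos.2 ht]
  calc ‖v x - approxDeriv t‖ ^ 2 + -12 * approx t * ‖u x - approx t‖ ^ 2
      ≤ (K * t ^ 3) ^ 2 + 12 * t⁻¹ * (K * t ^ 3) ^ 2 := by gcongr
    _ = K ^ 2 * t ^ 5 * (t + 12) := by field_simp
    _ ≤ K ^ 2 * t ^ 5 * 13 := by gcongr; linarith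
    _ = 13 * K ^ 2 * t * t ^ 2 * (t ^ 2) := by ring
    _ ≤ 13 * K ^ 2 * t * t ^ 2 * 1 := by gcongr; nlinarith
    _ = (13 * K ^ 2 * t) * t ^ 2 := by ring
    _ ≤ (98 / 10000) ^ 2 * t ^ 2 := by
      gcongr
      rw [le_div_iff₀ (by positivity)] at hτ2
      linarith
    _ = _ := by ring

/-! ### Continuation down to the origin -/

/-- The open half-strip `Re x > c`, `|Im x| < h`. -/
def halfStrip (c h : ℝ) : Set ℂ := {x | c < x.re ∧ |x.im| < h}

theorem isOpen_halfStrip (c h : ℝ) : IsOpen (halfStrip c h) :=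
  (isOpen_lt continuous_const Complex.continuous_re).inter
    (isOpen_lt (Complex.continuous_im.abs) continuous_const)

theorem convex_halfStrip (c h : ℝ) : Convex ℝ (halfStrip c h) := by
  have h1 : Convex ℝ {x : ℂ | c < x.re} := convex_halfSpace_re_gt c
  have h2 : Convex ℝ {x : ℂ | x.im < h} := convex_halfSpace_im_lt h
  have h3 : Convex ℝ {x : ℂ | -h < x.im} := convex_halfSpace_im_gt (-h)
  convert h1.inter (h3.inter h2) using 1
  ext x
  simp [halfStrip, abs_lt]

theorem ofReal_mem_halfStrip {c h x : ℝ} (hh : 0 < h) (hx : c < x) : (x : ℂ) ∈ halfStrip c h := by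
  simp [halfStrip, hh, hx]

theorem halfStrip_subset {c c' h h' : ℝ} (hc : c' ≤ c) (hh : h ≤ h') :
    halfStrip c h ⊆ halfStrip c' h' := fun _ hx => ⟨hc.trans_lt hx.1, hx.2.trans_le hh⟩

theorem SolvesOn.union {u : ℂ → ℂ} {S T : Set ℂ} (hS : IsOpen S) (hT : IsOpen T)
    (h1 : SolvesOn u S) (h2 : SolvesOn u T) : SolvesOn u (S ∪ T) :=
  ⟨h1.1.union_of_isOpen h2.1 hS hT, fun x hx => hx.elim (h1.2 x) (h2.2 x)⟩

/-- The energy estimate for an analytic solution on a half-strip with the tritronquée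
behaviour. -/
theorem SolvesOn.norm_sub_approx_le {u : ℂ → ℂ} {c h : ℝ} (hh : 0 < h)
    (hu : SolvesOn u (halfStrip c h))
    (has : HasTritronqueeAsymptotics (fun x => u x) (fun x => deriv u x)) {x : ℝ} (hx : 0 ≤ x)
    (hcx : c < x) :
    ‖u x - approx (tau x)‖ ≤ 98 / 10000 ∧ ‖deriv u x - approxDeriv (tau x)‖ ≤ 98 / 10000 := by
  refine norm_sub_approx_le_of_energy_le (u := fun x => u x) (v := fun x => deriv u x) hx
    (energy_le hx (fun y hy => ?_) (fun y hy => ?_) has.eventually_energy_le le_rfl)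
  · exact (hu.hasDerivAt (isOpen_halfStrip c h)
      (ofReal_mem_halfStrip hh (hcx.trans_le hy))).comp_ofReal
  · exact (hu.hasDerivAt_deriv (isOpen_halfStrip c h)
      (ofReal_mem_halfStrip hh (hcx.trans_le hy))).comp_ofReal

theorem abs_approx_le {x : ℝ} (hx : 0 ≤ x) : |approx (tau x)| ≤ 1 + x := by
  have h1 := neg_approx_le (tau_pos hx) (tau_le_one hx)
  have h2 := neg_twelve_approx_ge hx
  have h3 := eq_of_tau hx
  have hp := inv_pos.2 (tau_pos hx)
  rw [abs_of_nonpos (by linarith)]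
  nlinarith

theorem abs_approxDeriv_le {t : ℝ} (h0 : 0 < t) (h1 : t ≤ 1) : |approxDeriv t| ≤ 1 := by
  rw [abs_of_nonpos (approxDeriv_nonpos h0 h1)]
  have h3 : t ^ 3 ≤ 1 := pow_le_one₀ h0.le h1
  have h5 : t ^ 5 ≤ 1 := pow_le_one₀ h0.le h1
  have h7 : t ^ 7 ≤ 1 := pow_le_one₀ h0.le h1
  unfold approxDeriv
  linarith [pow_pos h0 6, pow_pos h0 8, pow_pos h0 9]

/-- One step of the continuation: the size of the step depends only on an upper bound `M` for the
position, because the energy estimate bounds the initial data. -/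
theorem exists_solvesOn_halfStrip_sub {u : ℂ → ℂ} {c h M : ℝ} (hh : 0 < h) (hc : 0 ≤ c)
    (hM : c + 3 ≤ M) (hu : SolvesOn u (halfStrip c h))
    (has : HasTritronqueeAsymptotics (fun x => u x) (fun x => deriv u x)) :
    ∃ (h' : ℝ) (U : ℂ → ℂ), 0 < h' ∧ h' ≤ h ∧ SolvesOn U (halfStrip (c - M⁻¹ / 4) h') ∧
      ∀ x ∈ halfStrip c h', U x = u x := by
  have hM0 : 0 < M := by linarith
  set ρ := M⁻¹ with hρdef
  have hρ : 0 < ρ := inv_pos.2 hM0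
  have hρ1 : ρ ≤ 1 := inv_le_one_of_one_le₀ (by linarith)
  set x₁ : ℝ := c + ρ / 4 with hx₁
  have hx₁0 : 0 ≤ x₁ := by positivity
  have hx₁c : c < x₁ := by linarith
  obtain ⟨hb0, hb1⟩ := hu.norm_sub_approx_le hh has hx₁0 hx₁c
  have ha : ‖u x₁‖ ≤ M := by
    have := norm_le_norm_sub_add (u x₁) (approx (tau x₁) : ℂ)
    rw [Complex.norm_real, Real.norm_eq_abs] at this
    have := abs_approx_le hx₁0
    linarith
  have hb : ‖deriv u x₁‖ ≤ M := by
    have := norm_le_norm_sub_add (deriv u x₁) (approxDeriv (tau x₁) : ℂ)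
    rw [Complex.norm_real, Real.norm_eq_abs] at this
    have := abs_approxDeriv_le (tau_pos hx₁0) (tau_le_one hx₁0)
    linarith
  have hM3 : 3 ≤ M := by linarith
  have hp : ∀ n : ℕ, ∀ k : ℝ, k / ρ ^ n = k * M ^ n := by
    intro n k; rw [hρdef, inv_pow, div_inv_eq_mul]
  have hM2 : M ≤ M ^ 2 := by nlinarith
  have hM23 : M ^ 2 ≤ M ^ 3 := pow_le_pow_right₀ (by linarith) (by norm_num)
  have hM24 : M ^ 2 * 9 ≤ M ^ 4 := by nlinarith
  have hM25 : M ^ 4 ≤ M ^ 5 := pow_le_pow_right₀ (by linarith) (by norm_num)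
  obtain ⟨V, hV, hV0, hV1⟩ := exists_solvesOn_ball (a := u x₁) (b := deriv u x₁) (x₀ := x₁) hρ
    (by rw [hp]; linarith) (by rw [hp]; linarith)
    (by
      rw [hp]
      refine (norm_sub_le _ _).trans ?_
      rw [norm_mul, norm_pow, norm_div, Complex.norm_real, Real.norm_of_nonneg hx₁0]
      have : ‖u x₁‖ ^ 2 ≤ M ^ 2 := by gcongr
      simp only [Complex.norm_ofNat]
      linarith)
    (by
      rw [hp, norm_div]
      have h1 := norm_sub_le (12 * u x₁ * deriv u x₁) 1
      rw [norm_mul, norm_mul] at h1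
      have : ‖u x₁‖ * ‖deriv u x₁‖ ≤ M * M := by gcongr
      simp only [Complex.norm_ofNat, norm_one] at h1 ⊢
      rw [div_le_iff₀ (by norm_num)]
      nlinarith)
  have hSo := isOpen_halfStrip c h
  have hagree : Set.EqOn u V (halfStrip c h ∩ Metric.ball (x₁ : ℂ) ρ) :=
    SolvesOn.eqOn (hSo.inter Metric.isOpen_ball)
      ((convex_halfStrip c h).inter (convex_ball _ _)).isPreconnected
      (hu.mono Set.inter_subset_left) (hV.mono Set.inter_subset_right) (x₀ := x₁)
      ⟨ofReal_mem_halfStrip hh hx₁c, Metric.mem_ball_self hρ⟩ hV0.symm hV1.symm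
  classical
  set h' := min h (ρ / 4) with hh'
  have hh'0 : 0 < h' := lt_min hh (by positivity)
  set T : Set ℂ := {x | c - ρ / 4 < x.re ∧ x.re < x₁ ∧ |x.im| < h'} with hT
  have hTo : IsOpen T := by
    refine IsOpen.inter (isOpen_lt continuous_const Complex.continuous_re)
      (IsOpen.inter (isOpen_lt Complex.continuous_re continuous_const)
      (isOpen_lt (Complex.continuous_im.abs) continuous_const))
  have hTball : T ⊆ Metric.ball (x₁ : ℂ) ρ := by
    rintro x ⟨hx1, hx2, hx3⟩
    rw [mem_ball_iff_norm]
    have him := hx3.trans_le (min_le_right _ _)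
    refine (Complex.norm_le_abs_re_add_abs_im _).trans_lt ?_
    simp only [Complex.sub_re, Complex.ofReal_re, Complex.sub_im, Complex.ofReal_im, sub_zero]
    rw [abs_of_neg (by linarith)]
    linarith
  set U : ℂ → ℂ := fun x => if c < x.re then u x else V x with hU
  have hUu : ∀ x ∈ halfStrip c h', U x = u x := fun x hx => if_pos hx.1
  have hUV : ∀ x ∈ T, U x = V x := by
    intro x hx
    by_cases hxc : c < x.re
    · rw [hU]
      simp only [if_pos hxc]
      exact hagree ⟨⟨hxc, hx.2.2.trans_le (min_le_left _ _)⟩, hTball hx⟩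
    · rw [hU]; simp only [if_neg hxc]
  refine ⟨h', U, hh'0, min_le_left _ _, ?_, hUu⟩
  refine (SolvesOn.union (isOpen_halfStrip c h') hTo
    ((hu.mono (halfStrip_subset le_rfl (min_le_left _ _))).congr (isOpen_halfStrip c h') hUu)
    ((hV.mono hTball).congr hTo hUV)).mono ?_
  rintro x ⟨hx1, hx2⟩
  by_cases hxc : c < x.re
  · exact Or.inl ⟨hxc, hx2⟩
  · exact Or.inr ⟨hx1, by linarith, hx2⟩

theorem HasTritronqueeAsymptotics.congr {u v : ℂ → ℂ} {c h : ℝ} (hh : 0 < h)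
    (has : HasTritronqueeAsymptotics (fun x => u x) (fun x => deriv u x))
    (huv : ∀ x ∈ halfStrip c h, v x = u x) :
    HasTritronqueeAsymptotics (fun x => v x) (fun x => deriv v x) := by
  obtain ⟨C, hC⟩ := has
  refine ⟨C, ?_⟩
  filter_upwards [hC, eventually_gt_atTop c] with x hx hcx
  have hmem := ofReal_mem_halfStrip hh hcx
  have e : v =ᶠ[𝓝 (x : ℂ)] u := by
    filter_upwards [(isOpen_halfStrip c h).mem_nhds hmem] with y hy using huv y hy
  rw [huv x hmem, e.deriv_eq]
  exact hx

/-- A solution with the tritronquée behaviour continues analytically to a half-strip around the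
closed half-line `[0, ∞)`. -/
theorem exists_continuation {u : ℂ → ℂ} {X h : ℝ} (hh : 0 < h) (hX : 0 ≤ X)
    (hu : SolvesOn u (halfStrip X h))
    (has : HasTritronqueeAsymptotics (fun x => u x) (fun x => deriv u x)) :
    ∃ (c h' : ℝ) (U : ℂ → ℂ), c < 0 ∧ 0 < h' ∧ SolvesOn U (halfStrip c h') ∧
      ∀ x ∈ halfStrip X h', U x = u x := by
  have key : ∀ n : ℕ, ∃ (c h' : ℝ) (U : ℂ → ℂ), (c < 0 ∨ c ≤ X - n * ((X + 3)⁻¹ / 4)) ∧ c ≤ X ∧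
      0 < h' ∧ SolvesOn U (halfStrip c h') ∧ ∀ x ∈ halfStrip X h', U x = u x := by
    intro n
    induction n with
    | zero => exact ⟨X, h, u, Or.inr (by simp), le_rfl, hh, hu, fun _ _ => rfl⟩
    | succ n ih =>
      obtain ⟨c, h', U, hc, hcX, hh', hU, hUu⟩ := ih
      rcases lt_or_ge c 0 with hc0 | hc0
      · exact ⟨c, h', U, Or.inl hc0, hcX, hh', hU, hUu⟩
      · have hc' := hc.resolve_left (not_lt.2 hc0)
        obtain ⟨h'', U', hh'', hle, hU', hUU⟩ := exists_solvesOn_halfStrip_sub (M := X + 3) hh'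
          hc0 (by linarith) hU (has.congr hh' hUu)
        have hpos : 0 < (X + 3)⁻¹ / 4 := by positivity
        refine ⟨_, h'', U', Or.inr ?_, by linarith, hh'', hU', fun x hx => ?_⟩
        · push_cast; linarith
        · rw [hUU x (halfStrip_subset hcX le_rfl hx), hUu x (halfStrip_subset le_rfl hle hx)]
  have hpos : 0 < (X + 3)⁻¹ / 4 := by positivity
  obtain ⟨n, hn⟩ := exists_nat_gt (X / ((X + 3)⁻¹ / 4))
  rw [div_lt_iff₀ hpos] at hn
  obtain ⟨c, h', U, hc, _, hh', hU, hUu⟩ := key n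
  exact ⟨c, h', U, hc.elim id fun h => by linarith, hh', hU, hUu⟩

/-! ### Rotating the sector -/

theorem exp_two_pi_I_div_five :
    Complex.exp (2 * Real.pi * Complex.I / 5) = Complex.exp (Real.pi * Complex.I / 5) ^ 2 := by
  rw [← Complex.exp_nat_mul]; congr 1; push_cast; ring

theorem exp_pi_I_div_five_pow_five : Complex.exp (Real.pi * Complex.I / 5) ^ 5 = -1 := by
  rw [← Complex.exp_nat_mul, ← Complex.exp_pi_mul_I]; congr 1; push_cast; ring

theorem norm_exp_pi_I_div_five : ‖Complex.exp (Real.pi * Complex.I / 5)‖ = 1 := by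
  rw [show (Real.pi : ℂ) * Complex.I / 5 = ((Real.pi / 5 : ℝ) : ℂ) * Complex.I by push_cast; ring]
  exact Complex.norm_exp_ofReal_mul_I _

theorem log_exp_pi_I_div_five :
    Complex.log (Complex.exp (Real.pi * Complex.I / 5)) = Real.pi * Complex.I / 5 := by
  have h : ((Real.pi : ℂ) * Complex.I / 5).im = Real.pi / 5 := by
    rw [show (Real.pi : ℂ) * Complex.I / 5 = ((Real.pi / 5 : ℝ) : ℂ) * Complex.I by
      push_cast; ring]
    simp
  apply Complex.log_exp <;> rw [h] <;> linarith [Real.pi_pos]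

theorem log_mul_exp_pi_I_div_five {x : ℂ} (hx : 0 < x.re) :
    Complex.log (x * Complex.exp (Real.pi * Complex.I / 5)) =
      Complex.log x + Real.pi * Complex.I / 5 := by
  have h := log_exp_pi_I_div_five
  have harg : (Complex.exp (Real.pi * Complex.I / 5)).arg = Real.pi / 5 := by
    rw [← Complex.log_im, h,
      show (Real.pi : ℂ) * Complex.I / 5 = ((Real.pi / 5 : ℝ) : ℂ) * Complex.I by push_cast; ring]
    simp
  have hxa := abs_lt.1 (Complex.abs_arg_lt_pi_div_two_iff.2 (Or.inl hx))
  rw [Complex.log_mul (fun h0 => by simp [h0] at hx) (Complex.exp_ne_zero _), h]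
  rw [harg]
  constructor <;> linarith [Real.pi_pos, hxa.1, hxa.2]

/-- The right half-plane is rotated into a closed subsector of the sector of the tritronquée
solution. -/
theorem mul_exp_mem_tritronqueeSector {x : ℂ} (hx : 0 < x.re) :
    x * Complex.exp (Real.pi * Complex.I / 5) ∈ tritronqueeSector (Real.pi / 10) := by
  have hxa := abs_lt.1 (Complex.abs_arg_lt_pi_div_two_iff.2 (Or.inl hx))
  have h : (x * Complex.exp (Real.pi * Complex.I / 5)).arg = x.arg + Real.pi / 5 := by
    rw [← Complex.log_im, log_mul_exp_pi_I_div_five hx, Complex.add_im, Complex.log_im,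
      show (Real.pi : ℂ) * Complex.I / 5 = ((Real.pi / 5 : ℝ) : ℂ) * Complex.I by push_cast; ring]
    simp
  constructor <;> rw [h] <;> linarith [Real.pi_pos, hxa.1, hxa.2]

theorem sqrt_rotated {x : ℂ} (hx : 0 < x.re) :
    Complex.exp (2 * Real.pi * Complex.I / 5) *
      (Complex.I * (x * Complex.exp (Real.pi * Complex.I / 5) / 6) ^ (1 / 2 : ℂ)) =
      -(x / 6) ^ (1 / 2 : ℂ) := by
  have hx6 : 0 < (x / 6).re := by
    rw [Complex.div_ofNat_re]; positivity
  have hne : x / 6 ≠ 0 := fun h0 => by simp [h0] at hx6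
  rw [show x * Complex.exp (Real.pi * Complex.I / 5) / 6 =
    x / 6 * Complex.exp (Real.pi * Complex.I / 5) by ring,
    Complex.cpow_def_of_ne_zero (mul_ne_zero hne (Complex.exp_ne_zero _)),
    Complex.cpow_def_of_ne_zero hne, log_mul_exp_pi_I_div_five hx6]
  nth_rewrite 2 [← Complex.exp_pi_div_two_mul_I]
  rw [← Complex.exp_add, ← Complex.exp_add, ← neg_one_mul, ← Complex.exp_pi_mul_I,
    ← Complex.exp_add]
  congr 1
  ring

/-- The rotated function in the variable `x = -t`. -/
theorem rotated_neg (y : ℂ → ℂ) (x : ℂ) : rotated y (-x) =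
    Complex.exp (2 * Real.pi * Complex.I / 5) * y (x * Complex.exp (Real.pi * Complex.I / 5)) := by
  rw [rotated, neg_neg]

theorem deriv_deriv_rotated_neg (y : ℂ → ℂ) (x : ℂ) :
    deriv (deriv fun x => rotated y (-x)) x = Complex.exp (Real.pi * Complex.I / 5) ^ 4 *
      deriv (deriv y) (x * Complex.exp (Real.pi * Complex.I / 5)) := by
  set ω := Complex.exp (Real.pi * Complex.I / 5) with hω
  have h1 : (fun x => rotated y (-x)) = fun x => ω ^ 2 * y (ω * x) := by
    funext x; rw [rotated_neg, exp_two_pi_I_div_five, mul_comm x]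
  have h2 : deriv (fun x => ω ^ 2 * y (ω * x)) = fun x => ω ^ 3 * deriv y (ω * x) := by
    funext x
    rw [deriv_const_mul_field, deriv_comp_mul_left, smul_eq_mul]
    ring
  rw [h1, h2, deriv_const_mul_field, deriv_comp_mul_left, smul_eq_mul, mul_comm x]
  ring

/-- The estimates defining a tritronquée solution, for large `x` in the right half-plane and in
the rotated form. -/
theorem IsTritronquee.exists_bound {y : ℂ → ℂ} (hy : IsTritronquee y) :
    ∃ R C : ℝ, 0 < R ∧ 0 ≤ C ∧ ∀ x : ℂ, R < x.re →
      AnalyticAt ℂ (fun x => rotated y (-x)) x ∧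
      deriv (deriv fun x => rotated y (-x)) x = 6 * rotated y (-x) ^ 2 - x ∧
      ‖rotated y (-x) + (x / 6) ^ (1 / 2 : ℂ)‖ ≤ C / ‖x‖ ^ 2 := by
  have hε : 0 < Real.pi / 10 := by positivity
  obtain ⟨C, hC⟩ := (hy.asymptotic _ hε).bound
  have hall := ((hy.analytic _ hε).and (hy.painleve _ hε)).and hC
  rw [sectorAtInfinity, eventually_inf_principal,
    hasBasis_cobounded_norm.eventually_iff] at hall
  obtain ⟨R, -, hR⟩ := hall
  refine ⟨max R 1, |C|, by positivity, abs_nonneg _, fun x hx => ?_⟩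
  have hx1 : 1 < x.re := (le_max_right _ _).trans_lt hx
  have hx0 : 0 < x.re := by linarith
  have hxn : x.re ≤ ‖x‖ := Complex.re_le_norm x
  have hxn0 : 0 < ‖x‖ := by linarith
  set ω := Complex.exp (Real.pi * Complex.I / 5) with hω
  have hnorm : ‖x * ω‖ = ‖x‖ := by rw [norm_mul, norm_exp_pi_I_div_five, mul_one]
  obtain ⟨⟨h1, h2⟩, h3⟩ := hR (show R ≤ ‖x * ω‖ by
    rw [hnorm]; linarith [(le_max_left R 1).trans_lt hx]) (mul_exp_mem_tritronqueeSector hx0)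
  refine ⟨?_, ?_, ?_⟩
  · have e : (fun x => rotated y (-x)) = fun x => ω ^ 2 * y (x * ω) := by
      funext x; rw [rotated_neg, exp_two_pi_I_div_five]
    rw [e]
    exact analyticAt_const.mul (AnalyticAt.comp_of_eq (f := fun x => x * ω) h1
      (analyticAt_id.mul analyticAt_const) rfl)
  · rw [deriv_deriv_rotated_neg, h2, rotated_neg, exp_two_pi_I_div_five, ← hω]
    have := exp_pi_I_div_five_pow_five
    rw [← hω] at this
    linear_combination x * this
  · set f := Complex.I * (x * ω / 6) ^ (1 / 2 : ℂ) with hf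
    have hs := sqrt_rotated hx0
    rw [← hω, ← hf] at hs
    have hf0 : f ≠ 0 := by
      have : x * ω / 6 ≠ 0 := by
        exact div_ne_zero (norm_pos_iff.1 (by rw [hnorm]; exact hxn0)) (by norm_num)
      rw [hf]
      exact mul_ne_zero Complex.I_ne_zero ((Complex.cpow_ne_zero_iff_of_exponent_ne_zero
        (by norm_num)).2 this)
    have he : rotated y (-x) + (x / 6) ^ (1 / 2 : ℂ) =
        Complex.exp (2 * Real.pi * Complex.I / 5) * (f * (y (x * ω) / f - 1)) := by
      rw [rotated_neg, ← neg_eq_iff_eq_neg.2 hs, ← hω]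
      field_simp
      ring
    have hn2 : ‖Complex.exp (2 * Real.pi * Complex.I / 5)‖ = 1 := by
      rw [exp_two_pi_I_div_five, norm_pow, norm_exp_pi_I_div_five, one_pow]
    have hfn : ‖f‖ ≤ ‖x‖ ^ (1 / 2 : ℝ) := by
      rw [hf, norm_mul, Complex.norm_I, one_mul,
        show (1 / 2 : ℂ) = ((1 / 2 : ℝ) : ℂ) by push_cast; ring, Complex.norm_cpow_real, norm_div,
        hnorm]
      gcongr
      simp only [Complex.norm_ofNat]
      linarith
    rw [he, norm_mul, hn2, one_mul, norm_mul]
    have h3' : ‖y (x * ω) / f - 1‖ ≤ |C| * ‖x‖ ^ (-(5 / 2) : ℝ) := by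
      refine h3.trans ?_
      rw [hnorm, Real.norm_of_nonneg (by positivity)]
      gcongr
      exact le_abs_self C
    calc ‖f‖ * ‖y (x * ω) / f - 1‖ ≤ ‖x‖ ^ (1 / 2 : ℝ) * (|C| * ‖x‖ ^ (-(5 / 2) : ℝ)) := by gcongr
      _ = |C| * (‖x‖ ^ (1 / 2 : ℝ) * ‖x‖ ^ (-(5 / 2) : ℝ)) := by ring
      _ = |C| / ‖x‖ ^ 2 := by
        rw [← Real.rpow_add hxn0, show (1 / 2 : ℝ) + -(5 / 2) = -(2 : ℕ) by norm_num,
          Real.rpow_neg hxn0.le, Real.rpow_natCast]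
        rfl

theorem ofReal_cpow_half {x : ℝ} (hx : 0 ≤ x) : ((x : ℂ) / 6) ^ (1 / 2 : ℂ) = (√(x / 6) : ℝ) := by
  rw [Real.sqrt_eq_rpow, Complex.ofReal_cpow (by positivity)]
  push_cast; rfl

/-- A tritronquée solution, rotated, solves the equation on a half-strip; the asymptotics may be
differentiated, by Cauchy's estimate on discs of fixed radius. -/
theorem IsTritronquee.exists_solvesOn {y : ℂ → ℂ} (hy : IsTritronquee y) :
    ∃ X : ℝ, 0 ≤ X ∧ SolvesOn (fun x => rotated y (-x)) (halfStrip X 1) ∧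
      HasTritronqueeAsymptotics (fun x => rotated y (-x))
        (fun x => deriv (fun x => rotated y (-x)) x) := by
  obtain ⟨R, C, hR, hC, h⟩ := hy.exists_bound
  refine ⟨R, hR.le, ⟨fun x hx => (h x hx.1).1.differentiableAt.differentiableWithinAt,
    fun x hx => (h x hx.1).2.1⟩, 8 * C, ?_⟩
  filter_upwards [eventually_gt_atTop (R + 1)] with x hx
  have hx0 : 0 < x := by linarith
  have hb := (h x (by simpa using by linarith)).2.2
  rw [Complex.norm_real, Real.norm_of_nonneg hx0.le, ofReal_cpow_half hx0.le] at hb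
  refine ⟨hb.trans (by gcongr; linarith), ?_⟩
  set u : ℂ → ℂ := fun x => rotated y (-x) with hu
  have hd : ∀ z ∈ Metric.closedBall (x : ℂ) (1 / 2), R < z.re ∧ x / 2 ≤ ‖z‖ := by
    intro z hz
    have h1 := (Complex.abs_re_le_norm (z - x)).trans (mem_closedBall_iff_norm.1 hz)
    rw [Complex.sub_re, Complex.ofReal_re] at h1
    have := (abs_le.1 h1).1
    exact ⟨by linarith, le_trans (by linarith) (Complex.re_le_norm z)⟩
  have hds : ∀ z : ℂ, 0 < z.re → HasDerivAt (fun z : ℂ => (z / 6) ^ (1 / 2 : ℂ))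
      (1 / 2 * (z / 6) ^ (1 / 2 - 1 : ℂ) * (1 / 6)) z := by
    intro z hz
    refine ((hasDerivAt_id z).div_const 6).cpow_const (Or.inl ?_)
    simp only [id]
    rw [Complex.div_ofNat_re]; positivity
  have hdiff : ∀ z ∈ Metric.closedBall (x : ℂ) (1 / 2),
      DifferentiableAt ℂ (fun z => u z + (z / 6) ^ (1 / 2 : ℂ)) z := fun z hz =>
    (h z (hd z hz).1).1.differentiableAt.add
      (hds z (hR.trans (hd z hz).1)).differentiableAt
  have hdc : DiffContOnCl ℂ (fun z => u z + (z / 6) ^ (1 / 2 : ℂ))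
      (Metric.ball (x : ℂ) (1 / 2)) := by
    refine DifferentiableOn.diffContOnCl fun z hz => ?_
    rw [closure_ball _ (by norm_num)] at hz
    exact (hdiff z hz).differentiableWithinAt
  have hcauchy := Complex.norm_deriv_le_of_forall_mem_sphere_norm_le (by norm_num) hdc
    (C := C / (x / 2) ^ 2) (fun z hz => by
      have hz' := hd z (Metric.sphere_subset_closedBall hz)
      refine (h z hz'.1).2.2.trans ?_
      gcongr
      exact hz'.2)
  have hxre : 0 < (x : ℂ).re := by simpa using hx0
  have hsum := ((h x (by simpa using by linarith)).1.differentiableAt.hasDerivAt.add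
    (hds x hxre)).deriv
  rw [show ((fun z => u z + (z / 6) ^ (1 / 2 : ℂ)) : ℂ → ℂ) =
    u + fun z : ℂ => (z / 6) ^ (1 / 2 : ℂ) from rfl, hsum] at hcauchy
  have hsq : (1 / 2 * ((x : ℂ) / 6) ^ (1 / 2 - 1 : ℂ) * (1 / 6)) =
      ((√(x / 6) / (2 * x) : ℝ) : ℂ) := by
    have hne : (x : ℂ) / 6 ≠ 0 := by
      have : (x : ℂ) ≠ 0 := by exact_mod_cast hx0.ne'
      exact div_ne_zero this (by norm_num)
    rw [Complex.cpow_sub _ _ hne, Complex.cpow_one, ofReal_cpow_half hx0.le]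
    push_cast
    field_simp
  rw [hsq] at hcauchy
  refine hcauchy.trans (le_of_eq ?_)
  field_simp
  norm_num

/-! ### Continuation along the ray and the radius of convergence -/

/-- Holomorphy on a disc bounds the radius of the Maclaurin series from below.  Discs slightly
larger than any `r < ρ` suffice, so that `ρ = ∞` is covered as well. -/
theorem le_radius_maclaurinSeries {G H : ℂ → ℂ} {ρ : ℝ≥0∞} (hG : G =ᶠ[𝓝 0] H)
    (hH : ∀ r : NNReal, (r : ℝ≥0∞) < ρ → ∃ s : ℝ, r < s ∧ DifferentiableOn ℂ H (Metric.ball 0 s)) :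
    ρ ≤ (maclaurinSeries G).radius := by
  refine ENNReal.le_of_forall_nnreal_lt fun r hr => ?_
  obtain ⟨s, hrs, hs⟩ := hH r hr
  have hmem : ((r : ℝ) : ℂ) ∈ Metric.ball (0 : ℂ) s := by
    rw [mem_ball_zero_iff, Complex.norm_real, Real.norm_of_nonneg r.coe_nonneg]; exact hrs
  have h1 := (Complex.hasSum_taylorSeries_on_ball hs hmem).summable.tendsto_atTop_zero.norm
  rw [norm_zero] at h1
  refine FormalMultilinearSeries.le_radius_of_tendsto _ (l := 0) (h1.congr fun n => ?_)
  rw [maclaurinSeries, FormalMultilinearSeries.ofScalars_norm, hG.iteratedDeriv_eq n]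
  simp only [sub_zero, smul_eq_mul, norm_mul, norm_inv, norm_div, norm_pow, Complex.norm_real,
    Real.norm_of_nonneg r.coe_nonneg]
  ring

theorem bisectorPoint_eq (s : ℝ) :
    bisectorPoint s = s * Complex.exp (Real.pi * Complex.I / 5) := rfl

/-- The two initial values of a solution with the tritronquée behaviour satisfy the bounds that the
majorant `(ρ - t)⁻²` with `ρ = 37/20` requires. -/
theorem SolvesOn.exists_ball {U : ℂ → ℂ} {c h : ℝ} (hc : c < 0) (hh : 0 < h)
    (hU : SolvesOn U (halfStrip c h))
    (has : HasTritronqueeAsymptotics (fun x => U x) (fun x => deriv U x)) :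
    ∃ V : ℂ → ℂ, SolvesOn V (Metric.ball 0 (37 / 20)) ∧ U =ᶠ[𝓝 0] V := by
  obtain ⟨h0, h1⟩ := hU.norm_sub_approx_le hh has le_rfl hc
  rw [tau_zero] at h0 h1
  have e0 : approx 1 = -749 / 4000 := by norm_num [approx]
  have e1 : approxDeriv 1 = -611 / 2000 := by norm_num [approxDeriv]
  rw [e0] at h0
  rw [e1] at h1
  simp only [Complex.ofReal_zero] at h0 h1
  set a := U 0
  set b := deriv U 0
  have hprod : ‖a * b - ((-749 / 4000 * (-611 / 2000) : ℝ) : ℂ)‖ ≤ 1 / 100 := by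
    have e : a * b - ((-749 / 4000 * (-611 / 2000) : ℝ) : ℂ) =
        (a - ((-749 / 4000 : ℝ) : ℂ)) * b +
          ((-749 / 4000 : ℝ) : ℂ) * (b - ((-611 / 2000 : ℝ) : ℂ)) := by
      push_cast; ring
    have hb : ‖b‖ ≤ 32 / 100 := by
      have := norm_le_norm_sub_add b ((-611 / 2000 : ℝ) : ℂ)
      rw [Complex.norm_real, Real.norm_eq_abs, abs_of_neg (by norm_num)] at this
      linarith
    rw [e]
    refine (norm_add_le _ _).trans ?_
    rw [norm_mul, norm_mul, Complex.norm_real, Real.norm_eq_abs,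
      abs_of_neg (show (-749 / 4000 : ℝ) < 0 by norm_num)]
    nlinarith [norm_nonneg b, norm_nonneg (a - ((-749 / 4000 : ℝ) : ℂ))]
  have ha : ‖a‖ ≤ 1971 / 10000 := by
    have := norm_le_norm_sub_add a ((-749 / 4000 : ℝ) : ℂ)
    rw [Complex.norm_real, Real.norm_eq_abs, abs_of_neg (by norm_num)] at this
    linarith
  have hb : ‖b‖ ≤ 3153 / 10000 := by
    have := norm_le_norm_sub_add b ((-611 / 2000 : ℝ) : ℂ)
    rw [Complex.norm_real, Real.norm_eq_abs, abs_of_neg (by norm_num)] at this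
    linarith
  obtain ⟨V, hV, hV0, hV1⟩ := exists_solvesOn_ball (a := a) (b := b) (x₀ := 0) (ρ := 37 / 20)
    (by norm_num) (ha.trans (by norm_num)) (hb.trans (by norm_num))
    (by
      rw [zero_div, sub_zero, norm_mul, norm_pow]
      have : ‖a‖ ^ 2 ≤ (1971 / 10000) ^ 2 := by gcongr
      simp only [Complex.norm_ofNat]
      linarith [show (3 : ℝ) * (1971 / 10000) ^ 2 ≤ 3 / (37 / 20) ^ 4 by norm_num])
    (by
      have e : (12 * a * b - 1) / 6 = 2 * (a * b - ((-749 / 4000 * (-611 / 2000) : ℝ) : ℂ)) +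
          ((2 * (-749 / 4000 * (-611 / 2000)) - 1 / 6 : ℝ) : ℂ) := by
        push_cast; ring
      rw [e]
      refine (norm_add_le _ _).trans ?_
      rw [norm_mul, Complex.norm_real, Real.norm_eq_abs]
      simp only [Complex.norm_ofNat]
      have hn : |2 * (-749 / 4000 * (-611 / 2000)) - 1 / 6| ≤ (53 / 1000 : ℝ) := by
        rw [abs_le]; norm_num
      linarith [show (2 : ℝ) * (1 / 100) + 53 / 1000 ≤ 4 / (37 / 20) ^ 5 by norm_num])
  have h00 : ((0 : ℝ) : ℂ) = 0 := Complex.ofReal_zero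
  have := SolvesOn.eventuallyEq (x₀ := 0) ((isOpen_halfStrip c h).inter Metric.isOpen_ball)
    (hU.mono Set.inter_subset_left) (hV.mono Set.inter_subset_right)
    ⟨ofReal_mem_halfStrip hh hc, by rw [h00]; exact Metric.mem_ball_self (by norm_num)⟩
    (by rw [h00]; exact hV0.symm) (by rw [h00]; exact hV1.symm)
  rw [h00] at this
  exact ⟨V, hV, this⟩

theorem IsTritronquee.exists_halfStrip {y : ℂ → ℂ} (hy : IsTritronquee y) :
    ∃ (X c h : ℝ) (U : ℂ → ℂ), c < 0 ∧ 0 < h ∧ SolvesOn U (halfStrip c h) ∧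
      HasTritronqueeAsymptotics (fun x => U x) (fun x => deriv U x) ∧
      ∀ s : ℝ, X < s → U s = rotated y (-s) := by
  obtain ⟨X, hX, hu, has⟩ := hy.exists_solvesOn
  obtain ⟨c, h, U, hc, hh, hU, hUu⟩ := exists_continuation one_pos hX hu has
  exact ⟨X, c, h, U, hc, hh, hU, has.congr hh hUu,
    fun s hs => hUu s (ofReal_mem_halfStrip hh hs)⟩

theorem IsTritronquee.exists_isContinuationToOrigin {y : ℂ → ℂ} (hy : IsTritronquee y) :
    ∃ (D : Set ℂ) (Y : ℂ → ℂ), IsContinuationToOrigin y D Y := by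
  obtain ⟨X, c, h, U, hc, hh, hU, -, hUy⟩ := hy.exists_halfStrip
  set ω := Complex.exp (Real.pi * Complex.I / 5) with hω
  have hω0 : ω ≠ 0 := Complex.exp_ne_zero _
  have hcont : Continuous fun z : ℂ => z * ω⁻¹ := by fun_prop
  refine ⟨(fun z => z * ω⁻¹) ⁻¹' halfStrip c h, fun z => (ω ^ 2)⁻¹ * U (z * ω⁻¹),
    (isOpen_halfStrip c h).preimage hcont, fun s hs => ?_, ?_, ?_⟩
  · rw [Set.mem_preimage, bisectorPoint_eq, ← hω, mul_inv_cancel_right₀ hω0]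
    exact ofReal_mem_halfStrip hh (hc.trans_le hs)
  · exact (hU.1.comp (f := fun z => z * ω⁻¹) (by fun_prop) fun z hz => hz).const_mul _
  · filter_upwards [eventually_gt_atTop X] with s hs
    rw [bisectorPoint_eq, ← hω, mul_inv_cancel_right₀ hω0, hUy s hs, rotated_neg,
      exp_two_pi_I_div_five, ← hω, inv_mul_cancel_left₀ (pow_ne_zero 2 hω0)]

/-- Any continuation agrees, near the origin, with the solution on the half-strip, by the identity
theorem along the ray, and that solution extends to the disc of radius `37/20`. -/
theorem IsContinuationToOrigin.le_radius {y : ℂ → ℂ} (hy : IsTritronquee y) {D : Set ℂ}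
    {Y : ℂ → ℂ} (hY : IsContinuationToOrigin y D Y) :
    (37 / 20 : ℝ≥0∞) ≤ (maclaurinSeries (rotated Y)).radius := by
  obtain ⟨X, c, h, U, hc, hh, hU, has, hUy⟩ := hy.exists_halfStrip
  obtain ⟨V, hV, hUV⟩ := hU.exists_ball hc hh has
  set ray : Set ℂ := (fun s : ℝ => (s : ℂ)) '' Set.Ici 0 with hray
  have hpre : IsPreconnected ray :=
    isPreconnected_Ici.image _ Complex.continuous_ofReal.continuousOn
  have hUan : AnalyticOnNhd ℂ U ray := by
    rintro _ ⟨s, hs, rfl⟩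
    exact hU.1.analyticAt ((isOpen_halfStrip c h).mem_nhds
      (ofReal_mem_halfStrip hh (hc.trans_le hs)))
  have hYan : AnalyticOnNhd ℂ (fun x => rotated Y (-x)) ray := by
    rintro _ ⟨s, hs, rfl⟩
    have h1 : AnalyticAt ℂ Y (s * Complex.exp (Real.pi * Complex.I / 5)) :=
      hY.differentiableOn.analyticAt (hY.isOpen.mem_nhds (hY.ray_mem s hs))
    have e : (fun x => rotated Y (-x)) = fun x => Complex.exp (2 * Real.pi * Complex.I / 5) *
        Y (x * Complex.exp (Real.pi * Complex.I / 5)) := by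
      funext x; rw [rotated_neg]
    rw [e]
    exact analyticAt_const.mul (AnalyticAt.comp_of_eq
      (f := fun x => x * Complex.exp (Real.pi * Complex.I / 5)) h1
      (analyticAt_id.mul analyticAt_const) rfl)
  have hfar : ∀ᶠ s : ℝ in atTop, rotated Y (-s) = U s := by
    filter_upwards [hY.eventually_eq, eventually_gt_atTop X] with s hs hsX
    rw [hUy s hsX, rotated_neg, rotated_neg, ← bisectorPoint_eq, hs]
  obtain ⟨S, hS⟩ := (hfar.and (eventually_ge_atTop 0)).exists_forall_of_atTop
  have hSmem : (S : ℂ) ∈ ray := ⟨S, (hS S le_rfl).2, rfl⟩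
  have hnear : (fun x => rotated Y (-x)) =ᶠ[𝓝 (S : ℂ)] U :=
    eventuallyEq_of_eq_right (hYan _ hSmem) (hUan _ hSmem) (by
      filter_upwards [self_mem_nhdsWithin] with s hs using (hS s (le_of_lt hs)).1)
  have hEq := hYan.eqOn_of_preconnected_of_eventuallyEq hUan hpre hSmem hnear
  have h00 : ((0 : ℝ) : ℂ) = 0 := Complex.ofReal_zero
  have h0mem : ((0 : ℝ) : ℂ) ∈ ray := ⟨0, Set.mem_Ici.2 le_rfl, rfl⟩
  have hzero : (fun x => rotated Y (-x)) =ᶠ[𝓝 ((0 : ℝ) : ℂ)] U :=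
    eventuallyEq_of_eq_right (hYan _ h0mem) (hUan _ h0mem) (by
      filter_upwards [self_mem_nhdsWithin] with s hs
      exact hEq ⟨s, le_of_lt (Set.mem_Ioi.1 hs), rfl⟩)
  rw [h00] at hzero
  have hneg : Tendsto (fun t : ℂ => -t) (𝓝 0) (𝓝 0) := by
    simpa using (continuous_neg (G := ℂ)).tendsto 0
  refine le_radius_maclaurinSeries (H := fun t => V (-t)) ?_ fun r hr => ⟨37 / 20, ?_, ?_⟩
  · filter_upwards [hneg.eventually (hzero.trans hUV)] with t ht
    simpa using ht
  · have h2 := (ENNReal.toReal_lt_toReal ENNReal.coe_ne_top (by finiteness)).2 hr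
    simpa using h2
  · refine hV.1.comp (by fun_prop) fun t ht => ?_
    simpa using ht

/-! ### A region invariant under translation to the right -/

/-- The distance from `0` to the horizontal half-line `{ξ + s : s ≥ 0}`. -/
def rightDist (ξ : ℂ) : ℝ := √((max ξ.re 0) ^ 2 + ξ.im ^ 2)

/-- The region on which the integral equation is solved.  It is open and invariant under
translation to the right, stays away from `0`, and contains, near infinity, every closed subsector
of the plane cut along the negative half-line. -/
def rightRegion (K : ℝ) : Set ℂ := {ξ | K ^ 2 * ‖ξ‖ < rightDist ξ ^ 2}

theorem rightDist_sq (ξ : ℂ) : rightDist ξ ^ 2 = (max ξ.re 0) ^ 2 + ξ.im ^ 2 :=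
  Real.sq_sqrt (by positivity)

theorem rightDist_nonneg (ξ : ℂ) : 0 ≤ rightDist ξ := Real.sqrt_nonneg _

theorem rightDist_le_norm (ξ : ℂ) : rightDist ξ ≤ ‖ξ‖ := by
  refine le_of_sq_le_sq ?_ (norm_nonneg _)
  rw [rightDist_sq, Complex.sq_norm, Complex.normSq_apply]
  rcases le_total ξ.re 0 with h | h
  · rw [max_eq_right h]; nlinarith
  · rw [max_eq_left h]; nlinarith

theorem rightDist_le_add (ξ : ℂ) {s : ℝ} (hs : 0 ≤ s) : rightDist ξ ≤ rightDist (ξ + s) := by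
  refine Real.sqrt_le_sqrt ?_
  simp only [Complex.add_re, Complex.ofReal_re, Complex.add_im, Complex.ofReal_im, add_zero]
  have : max ξ.re 0 ≤ max (ξ.re + s) 0 := max_le_max (by linarith) le_rfl
  have h0 : 0 ≤ max ξ.re 0 := le_max_right _ _
  gcongr

theorem rightDist_sq_add_le (ξ : ℂ) {s : ℝ} (hs : 0 ≤ s) :
    rightDist ξ ^ 2 + (s - max (-ξ.re) 0) ^ 2 ≤ ‖ξ + s‖ ^ 2 := by
  rw [rightDist_sq, Complex.sq_norm, Complex.normSq_apply]
  simp only [Complex.add_re, Complex.ofReal_re, Complex.add_im, Complex.ofReal_im, add_zero]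
  rcases le_total ξ.re 0 with h | h
  · rw [max_eq_right h, max_eq_left (by linarith)]; nlinarith
  · rw [max_eq_left h, max_eq_right (by linarith)]; nlinarith [mul_nonneg h hs]

theorem continuous_rightDist : Continuous rightDist := by
  unfold rightDist
  fun_prop

theorem isOpen_rightRegion (K : ℝ) : IsOpen (rightRegion K) :=
  isOpen_lt (by fun_prop) (continuous_rightDist.pow 2)

section region

variable {K : ℝ} {ξ : ℂ}

theorem rightDist_pos (hξ : ξ ∈ rightRegion K) : 0 < rightDist ξ := by
  have h : K ^ 2 * ‖ξ‖ < rightDist ξ ^ 2 := hξ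
  have : 0 < rightDist ξ ^ 2 := lt_of_le_of_lt (by positivity) h
  exact (rightDist_nonneg ξ).lt_of_ne fun h0 => by simp [← h0] at this

theorem sq_lt_rightDist (hξ : ξ ∈ rightRegion K) : K ^ 2 < rightDist ξ := by
  have h : K ^ 2 * ‖ξ‖ < rightDist ξ ^ 2 := hξ
  have hp := rightDist_pos hξ
  have : K ^ 2 * rightDist ξ ≤ K ^ 2 * ‖ξ‖ := by gcongr; exact rightDist_le_norm ξ
  nlinarith

theorem one_le_norm_of_mem (hK : 1 ≤ K) (hξ : ξ ∈ rightRegion K) : 1 ≤ ‖ξ‖ := by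
  have h1 := sq_lt_rightDist hξ
  have h2 := rightDist_le_norm ξ
  nlinarith

theorem mem_slitPlane_of_mem_rightRegion (hξ : ξ ∈ rightRegion K) : ξ ∈ Complex.slitPlane := by
  rw [Complex.mem_slitPlane_iff]
  by_contra! h
  have hp := rightDist_pos hξ
  rw [rightDist, max_eq_right h.1, h.2] at hp
  simp at hp

theorem add_mem_rightRegion (hξ : ξ ∈ rightRegion K) {s : ℝ} (hs : 0 ≤ s) :
    ξ + s ∈ rightRegion K := by
  have h : K ^ 2 * ‖ξ‖ < rightDist ξ ^ 2 := hξ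
  have hmono := rightDist_le_add ξ hs
  have hp := rightDist_pos hξ
  have hlt := sq_lt_rightDist hξ
  change K ^ 2 * ‖ξ + s‖ < rightDist (ξ + s) ^ 2
  rcases le_total (ξ + s).re 0 with hre | hre
  -- moving towards the imaginary axis decreases the norm
  · have hn : ‖ξ + s‖ ≤ ‖ξ‖ := by
      refine le_of_sq_le_sq ?_ (norm_nonneg _)
      rw [Complex.sq_norm, Complex.sq_norm, Complex.normSq_apply, Complex.normSq_apply]
      simp only [Complex.add_re, Complex.ofReal_re, Complex.add_im, Complex.ofReal_im,
        add_zero] at hre ⊢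
      nlinarith
    calc K ^ 2 * ‖ξ + s‖ ≤ K ^ 2 * ‖ξ‖ := by gcongr
      _ < rightDist ξ ^ 2 := h
      _ ≤ _ := by gcongr
  -- in the right half-plane the distance is the norm
  · have hn : rightDist (ξ + s) = ‖ξ + s‖ := by
      rw [rightDist, max_eq_left hre, Complex.norm_def, Complex.normSq_apply]
      congr 1; ring
    rw [hn, sq ‖ξ + s‖]
    rw [hn] at hmono
    have : 0 < ‖ξ + s‖ := by linarith
    gcongr
    linarith

theorem inv_norm_add_sq_le (hK : 1 ≤ K) (hξ : ξ ∈ rightRegion K) {s : ℝ} (hs : 0 ≤ s) :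
    (‖ξ + s‖ ^ 2)⁻¹ ≤ (1 + (1 + ‖ξ‖) ^ 2) * (1 + s ^ 2)⁻¹ := by
  have h1 := one_le_norm_of_mem hK (add_mem_rightRegion hξ hs)
  have h2 : s ≤ ‖ξ + s‖ * (1 + ‖ξ‖) := by
    have h3 : ‖(s : ℂ)‖ ≤ ‖ξ + s‖ + ‖ξ‖ := by
      calc ‖(s : ℂ)‖ = ‖(ξ + s) - ξ‖ := by rw [add_sub_cancel_left]
        _ ≤ _ := norm_sub_le _ _
    rw [Complex.norm_real, Real.norm_of_nonneg hs] at h3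
    nlinarith [norm_nonneg ξ]
  rw [← div_eq_mul_inv, inv_eq_one_div, div_le_div_iff₀ (by positivity) (by positivity)]
  have h4 : s ^ 2 ≤ (‖ξ + s‖ * (1 + ‖ξ‖)) ^ 2 := by gcongr
  nlinarith

theorem integrable_inv_sq_add_sq {m : ℝ} (hm : 0 < m) (a : ℝ) :
    MeasureTheory.Integrable (fun s : ℝ => (m ^ 2 + (s - a) ^ 2)⁻¹) ∧
      ∫ s : ℝ, (m ^ 2 + (s - a) ^ 2)⁻¹ = Real.pi / m := by
  have e : (fun s : ℝ => (m ^ 2 + (s - a) ^ 2)⁻¹) =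
      fun s => (m ^ 2)⁻¹ * (1 + ((s - a) / m) ^ 2)⁻¹ := by
    funext s; rw [← mul_inv]; congr 1; field_simp
  constructor
  · rw [e]
    exact ((integrable_inv_one_add_sq.comp_div hm.ne').comp_sub_right a).const_mul _
  · rw [e, MeasureTheory.integral_const_mul,
      MeasureTheory.integral_sub_right_eq_self (fun s : ℝ => (1 + (s / m) ^ 2)⁻¹) a,
      MeasureTheory.Measure.integral_comp_div (fun s : ℝ => (1 + s ^ 2)⁻¹) m,
      integral_univ_inv_one_add_sq, abs_of_pos hm, smul_eq_mul]
    field_simp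

/-- Integrals along horizontal half-lines gain a factor `π / rightDist ξ`. -/
theorem norm_integral_Ioi_le {G : ℝ → ℂ} {D : ℝ} (hD : 0 ≤ D) (hξ : ξ ∈ rightRegion K)
    (hG : ∀ s : ℝ, 0 < s → ‖G s‖ ≤ D * (‖ξ + s‖ ^ 2)⁻¹) :
    ‖∫ s in Set.Ioi (0 : ℝ), G s‖ ≤ D * (Real.pi / rightDist ξ) := by
  have hp := rightDist_pos hξ
  obtain ⟨hi, hint⟩ := integrable_inv_sq_add_sq hp (max (-ξ.re) 0)
  have hle := MeasureTheory.norm_integral_le_of_norm_le (μ := MeasureTheory.volume.restrict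
    (Set.Ioi (0 : ℝ))) (f := G) (hi.const_mul D).integrableOn (by
      filter_upwards [MeasureTheory.ae_restrict_mem measurableSet_Ioi] with s hs
      refine (hG s hs).trans ?_
      gcongr
      exact rightDist_sq_add_le ξ (le_of_lt hs))
  refine hle.trans ?_
  rw [← hint, ← MeasureTheory.integral_const_mul]
  exact MeasureTheory.setIntegral_le_integral (hi.const_mul D)
    (Eventually.of_forall fun s => by positivity)

end region

/-! ### The integral operator -/

section operator

variable {K : ℝ} {F : ℂ → ℂ} {M : ℝ}

/-- `∫₀^∞ k(s) F(ξ + s) ds`, for `k = sin` the decaying solution of `V'' + V = F`. -/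
def rightIntegral (k : ℝ → ℝ) (F : ℂ → ℂ) (ξ : ℂ) : ℂ :=
  ∫ s in Set.Ioi (0 : ℝ), (k s : ℂ) * F (ξ + s)

theorem continuousOn_comp_add (hF : ContinuousOn F (rightRegion K)) {ξ : ℂ}
    (hξ : ξ ∈ rightRegion K) : ContinuousOn (fun s : ℝ => F (ξ + s)) (Set.Ioi 0) :=
  hF.comp (by fun_prop) fun _ hs => add_mem_rightRegion hξ (le_of_lt hs)

/-- Differentiation under the integral sign followed by an integration by parts. -/
theorem hasDerivAt_rightIntegral (hK : 1 ≤ K) (hM : 0 ≤ M)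
    (hF : DifferentiableOn ℂ F (rightRegion K))
    (hFM : ∀ ξ ∈ rightRegion K, ‖F ξ‖ ≤ M * (‖ξ‖ ^ 2)⁻¹) {k k' : ℝ → ℝ}
    (hk : ∀ s, HasDerivAt k (k' s) s) (hk' : Continuous k') (hk1 : ∀ s, |k s| ≤ 1)
    (hk1' : ∀ s, |k' s| ≤ 1) {ξ : ℂ} (hξ : ξ ∈ rightRegion K) :
    HasDerivAt (rightIntegral k F) (-(k 0 : ℂ) * F ξ - rightIntegral k' F ξ) ξ := by
  have hopen := isOpen_rightRegion K
  have hkc : Continuous k := continuous_iff_continuousAt.2 fun s => (hk s).continuousAt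
  have hkC : Continuous fun s : ℝ => (k s : ℂ) := Complex.continuous_ofReal.comp hkc
  have hkC' : Continuous fun s : ℝ => (k' s : ℂ) := Complex.continuous_ofReal.comp hk'
  have hdF := hF.deriv hopen
  obtain ⟨ε', hε', hball⟩ := Metric.nhds_basis_closedBall.mem_iff.1 (hopen.mem_nhds hξ)
  set ε := ε' / 2 with hε
  have hε0 : 0 < ε := by positivity
  set Q := 1 + (1 + (‖ξ‖ + ε')) ^ 2 with hQ
  have hQ0 : 0 < Q := by positivity
  -- uniform decay along all half-lines starting near `ξ`
  have hdecay : ∀ ζ ∈ Metric.closedBall ξ ε', ∀ s : ℝ, 0 ≤ s →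
      ‖F (ζ + s)‖ ≤ M * Q * (1 + s ^ 2)⁻¹ := by
    intro ζ hζ s hs
    have hζn : ‖ζ‖ ≤ ‖ξ‖ + ε' := by
      have := norm_le_norm_sub_add ζ ξ
      linarith [mem_closedBall_iff_norm.1 hζ]
    calc ‖F (ζ + s)‖ ≤ M * (‖ζ + s‖ ^ 2)⁻¹ := hFM _ (add_mem_rightRegion (hball hζ) hs)
      _ ≤ M * ((1 + (1 + ‖ζ‖) ^ 2) * (1 + s ^ 2)⁻¹) := by
        gcongr; exact inv_norm_add_sq_le hK (hball hζ) hs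
      _ ≤ M * (Q * (1 + s ^ 2)⁻¹) := by rw [hQ]; gcongr
      _ = _ := by ring
  have hdecay' : ∀ ζ ∈ Metric.ball ξ ε, ∀ s : ℝ, 0 ≤ s →
      ‖deriv F (ζ + s)‖ ≤ M * Q / ε * (1 + s ^ 2)⁻¹ := by
    intro ζ hζ s hs
    have hsub : ∀ z ∈ Metric.closedBall (ζ + s) ε, z - s ∈ Metric.closedBall ξ ε' := by
      intro z hz
      rw [mem_closedBall_iff_norm] at hz ⊢
      rw [mem_ball_iff_norm] at hζ
      calc ‖z - s - ξ‖ = ‖(z - (ζ + s)) + (ζ - ξ)‖ := by congr 1; ring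
        _ ≤ ‖z - (ζ + s)‖ + ‖ζ - ξ‖ := norm_add_le _ _
        _ ≤ ε' := by rw [hε] at hz hζ; linarith
    have hin : ∀ z ∈ Metric.closedBall (ζ + s) ε, z ∈ rightRegion K := by
      intro z hz
      have := add_mem_rightRegion (hball (hsub z hz)) hs
      rwa [sub_add_cancel] at this
    have hdc : DiffContOnCl ℂ F (Metric.ball (ζ + s) ε) := by
      refine DifferentiableOn.diffContOnCl fun z hz => ?_
      rw [closure_ball _ hε0.ne'] at hz
      exact (hF.differentiableAt (hopen.mem_nhds (hin z hz))).differentiableWithinAt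
    refine (Complex.norm_deriv_le_of_forall_mem_sphere_norm_le hε0 hdc
      (C := M * Q * (1 + s ^ 2)⁻¹) fun z hz => ?_).trans (le_of_eq (by ring))
    have := hdecay (z - s) (hsub z (Metric.sphere_subset_closedBall hz)) s hs
    rwa [sub_add_cancel] at this
  have hballε : Metric.ball ξ ε ⊆ Metric.closedBall ξ ε' :=
    Metric.ball_subset_closedBall.trans (Metric.closedBall_subset_closedBall (by rw [hε]; linarith))
  have hξc : ξ ∈ Metric.closedBall ξ ε' := Metric.mem_closedBall_self hε'.le
  have hξb : ξ ∈ Metric.ball ξ ε := Metric.mem_ball_self hε0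
  have hmeas : ∀ {k : ℝ → ℝ}, Continuous (fun s : ℝ => (k s : ℂ)) → ∀ {G : ℂ → ℂ},
      ContinuousOn G (rightRegion K) → ∀ ζ ∈ Metric.ball ξ ε, MeasureTheory.AEStronglyMeasurable
      (fun s : ℝ => (k s : ℂ) * G (ζ + s)) (MeasureTheory.volume.restrict (Set.Ioi 0)) :=
    fun hk G hG ζ hζ => (hk.continuousOn.mul
      (continuousOn_comp_add hG (hball (hballε hζ)))).aestronglyMeasurable measurableSet_Ioi
  have hbnd : ∀ {k : ℝ → ℝ}, (∀ s, |k s| ≤ 1) → ∀ (w : ℂ) (s c : ℝ), ‖w‖ ≤ c →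
      ‖(k s : ℂ) * w‖ ≤ c := by
    intro k hk w s c hw
    rw [norm_mul, Complex.norm_real, Real.norm_eq_abs]
    exact (mul_le_of_le_one_left (norm_nonneg _) (hk s)).trans hw
  have hint : ∀ c : ℝ, MeasureTheory.IntegrableOn (fun s : ℝ => c * (1 + s ^ 2)⁻¹) (Set.Ioi 0) :=
    fun c => (integrable_inv_one_add_sq.const_mul c).integrableOn
  have hintF : ∀ {k : ℝ → ℝ}, (∀ s, |k s| ≤ 1) → Continuous (fun s : ℝ => (k s : ℂ)) →
      MeasureTheory.IntegrableOn (fun s : ℝ => (k s : ℂ) * F (ξ + s)) (Set.Ioi 0) := by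
    intro k hk hkc
    refine (hint (M * Q)).mono' (hmeas hkc hF.continuousOn ξ hξb) ?_
    filter_upwards [MeasureTheory.ae_restrict_mem measurableSet_Ioi] with s hs
    exact hbnd hk _ _ _ (hdecay ξ hξc s (le_of_lt hs))
  have hder := hasDerivAt_integral_of_dominated_loc_of_deriv_le
    (μ := MeasureTheory.volume.restrict (Set.Ioi (0 : ℝ)))
    (F := fun ζ s => (k s : ℂ) * F (ζ + s)) (F' := fun ζ s => (k s : ℂ) * deriv F (ζ + s))
    (bound := fun s => M * Q / ε * (1 + s ^ 2)⁻¹) (Metric.ball_mem_nhds ξ hε0)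
    (by filter_upwards [Metric.ball_mem_nhds ξ hε0] with ζ hζ using
      hmeas hkC hF.continuousOn ζ hζ)
    (hintF hk1 hkC) (hmeas hkC hdF.continuousOn ξ hξb)
    (by
      filter_upwards [MeasureTheory.ae_restrict_mem measurableSet_Ioi] with s hs ζ hζ
      exact hbnd hk1 _ _ _ (hdecay' ζ hζ s (le_of_lt hs)))
    (hint _)
    (by
      filter_upwards [MeasureTheory.ae_restrict_mem measurableSet_Ioi] with s hs ζ hζ
      have := (hF.differentiableAt (hopen.mem_nhds (add_mem_rightRegion (hball (hballε hζ))
        (le_of_lt hs)))).hasDerivAt.comp_add_const ζ (s : ℂ)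
      exact this.const_mul _)
  have hparts : ∫ s in Set.Ioi (0 : ℝ), ((k' s : ℂ) * F (ξ + s) + (k s : ℂ) * deriv F (ξ + s)) =
      0 - (k 0 : ℂ) * F (ξ + (0 : ℝ)) := by
    refine MeasureTheory.integral_Ioi_of_hasDerivAt_of_tendsto'
      (f := fun s : ℝ => (k s : ℂ) * F (ξ + s)) (fun s hs => ?_)
      ((hintF hk1' hkC').add hder.1) ?_
    · have h1 := (hF.differentiableAt (hopen.mem_nhds
        (add_mem_rightRegion hξ hs))).hasDerivAt.comp_const_add ξ (s : ℂ)
      exact (hk s).ofReal_comp.mul h1.comp_ofReal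
    · have hlim : Tendsto (fun s : ℝ => M * Q * (1 + s ^ 2)⁻¹) atTop (𝓝 0) := by
        have : Tendsto (fun s : ℝ => 1 + s ^ 2) atTop atTop :=
          tendsto_atTop_add_const_left _ _ (tendsto_pow_atTop two_ne_zero)
        simpa using this.inv_tendsto_atTop.const_mul (M * Q)
      refine squeeze_zero_norm' ?_ hlim
      filter_upwards [eventually_ge_atTop 0] with s hs
      exact hbnd hk1 _ _ _ (hdecay ξ hξc s hs)
  rw [MeasureTheory.integral_add (hintF hk1' hkC') hder.1] at hparts
  refine hder.2.congr_deriv ?_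
  simp only [rightIntegral]
  rw [Complex.ofReal_zero, add_zero] at hparts
  linear_combination hparts

/-- `V = ∫₀^∞ sin(s) F(ξ + s) ds` is analytic and solves `V'' + V = F`. -/
theorem rightIntegral_sin (hK : 1 ≤ K) (hM : 0 ≤ M)
    (hF : DifferentiableOn ℂ F (rightRegion K))
    (hFM : ∀ ξ ∈ rightRegion K, ‖F ξ‖ ≤ M * (‖ξ‖ ^ 2)⁻¹) :
    DifferentiableOn ℂ (rightIntegral Real.sin F) (rightRegion K) ∧
      ∀ ξ ∈ rightRegion K, deriv (deriv (rightIntegral Real.sin F)) ξ =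
        F ξ - rightIntegral Real.sin F ξ := by
  have h1 : ∀ ξ ∈ rightRegion K, HasDerivAt (rightIntegral Real.sin F)
      (-rightIntegral Real.cos F ξ) ξ := fun ξ hξ => by
    have := hasDerivAt_rightIntegral hK hM hF hFM Real.hasDerivAt_sin Real.continuous_cos
      Real.abs_sin_le_one Real.abs_cos_le_one hξ
    simpa using this
  have h2 : ∀ ξ ∈ rightRegion K, HasDerivAt (rightIntegral Real.cos F)
      (-F ξ + rightIntegral Real.sin F ξ) ξ := fun ξ hξ => by
    have := hasDerivAt_rightIntegral hK hM hF hFM Real.hasDerivAt_cos Real.continuous_sin.neg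
      Real.abs_cos_le_one (fun s => by simpa using Real.abs_sin_le_one s) hξ
    refine this.congr_deriv ?_
    simp [rightIntegral, MeasureTheory.integral_neg]
  refine ⟨fun ξ hξ => (h1 ξ hξ).differentiableAt.differentiableWithinAt, fun ξ hξ => ?_⟩
  have e : deriv (rightIntegral Real.sin F) =ᶠ[𝓝 ξ] fun ξ => -rightIntegral Real.cos F ξ := by
    filter_upwards [(isOpen_rightRegion K).mem_nhds hξ] with ζ hζ using (h1 ζ hζ).deriv
  rw [e.deriv_eq, (h2 ξ hξ).fun_neg.deriv]
  ring

end operator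

/-! ### The nonlinear integral equation -/

/-- The principal branch of `ξ^(-1/2)`. -/
def invSqrt (ξ : ℂ) : ℂ := Complex.exp (-Complex.log ξ / 2)

theorem invSqrt_sq {ξ : ℂ} (hξ : ξ ≠ 0) : invSqrt ξ ^ 2 = ξ⁻¹ := by
  rw [invSqrt, ← Complex.exp_nat_mul]
  rw [show ((2 : ℕ) : ℂ) * (-Complex.log ξ / 2) = -Complex.log ξ by push_cast; ring,
    Complex.exp_neg, Complex.exp_log hξ]

theorem norm_invSqrt_sq {ξ : ℂ} (hξ : ξ ≠ 0) : ‖invSqrt ξ‖ ^ 2 = ‖ξ‖⁻¹ := by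
  rw [← norm_pow, invSqrt_sq hξ, norm_inv]

theorem differentiableOn_invSqrt (K : ℝ) : DifferentiableOn ℂ invSqrt (rightRegion K) := by
  intro ξ hξ
  have := (Complex.hasDerivAt_log (mem_slitPlane_of_mem_rightRegion hξ)).differentiableAt
  exact ((this.neg.div_const 2).cexp).differentiableWithinAt

/-- The right-hand side of `W'' + W = A ξ⁻² W + B ξ^(-1/2) W² + C ξ^(-7/2)`. -/
def forcing (A B C : ℂ) (W : ℂ → ℂ) (ξ : ℂ) : ℂ :=
  A * invSqrt ξ ^ 4 * W ξ + B * invSqrt ξ * W ξ ^ 2 + C * invSqrt ξ ^ 7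

section picard

variable {K : ℝ} {ξ : ℂ} {A B C : ℂ}

/-- The three size relations between `‖ξ^(-1/2)‖`, `rightDist ξ` and `K` that make each term of
`forcing` smaller, by a factor `K`, than what the integral operator can absorb. -/
theorem region_bounds (hK : 1 ≤ K) (hξ : ξ ∈ rightRegion K) :
    ‖invSqrt ξ‖ ^ 4 * (rightDist ξ ^ 2)⁻¹ ≤ ‖invSqrt ξ‖ ^ 4 * (rightDist ξ)⁻¹ / K ∧
    ‖invSqrt ξ‖ * ((rightDist ξ ^ 2)⁻¹) ^ 2 ≤ ‖invSqrt ξ‖ ^ 4 * (rightDist ξ)⁻¹ / K ∧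
    ‖invSqrt ξ‖ ^ 7 ≤ ‖invSqrt ξ‖ ^ 4 * (rightDist ξ)⁻¹ / K := by
  have hm := rightDist_pos hξ
  have hKm := sq_lt_rightDist hξ
  have h1 := one_le_norm_of_mem hK hξ
  have hξ0 : ξ ≠ 0 := norm_pos_iff.1 (by linarith)
  have hρ2 := norm_invSqrt_sq hξ0
  have hρ : 0 < ‖invSqrt ξ‖ := norm_pos_iff.2 (Complex.exp_ne_zero _)
  have hreg : K ^ 2 * ‖ξ‖ < rightDist ξ ^ 2 := hξ
  have hle := rightDist_le_norm ξ
  generalize ‖invSqrt ξ‖ = ρ at *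
  generalize rightDist ξ = m at *
  have hK0 : 0 < K := by linarith
  have hmK : K ≤ m := by nlinarith
  have hρm : ρ ^ 2 * m ≤ 1 := by
    rw [hρ2, inv_mul_le_iff₀ (by linarith)]; linarith
  have hKρ : K ≤ ρ * m := by
    refine le_of_sq_le_sq ?_ (by positivity)
    rw [mul_pow, hρ2, inv_mul_eq_div, le_div_iff₀ (by linarith)]
    exact hreg.le
  refine ⟨?_, ?_, ?_⟩
  · rw [mul_div_assoc, div_eq_mul_inv, ← mul_inv]
    gcongr
    nlinarith
  · have : K ≤ (ρ * m) ^ 3 := by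
      calc K ≤ ρ * m := hKρ
        _ ≤ (ρ * m) ^ 3 := le_self_pow₀ (hK.trans hKρ) (by norm_num)
    rw [le_div_iff₀ hK0]
    calc ρ * ((m ^ 2)⁻¹) ^ 2 * K ≤ ρ * ((m ^ 2)⁻¹) ^ 2 * (ρ * m) ^ 3 := by gcongr
      _ = ρ ^ 4 * m⁻¹ := by field_simp
  · have hρK : ρ * K ≤ 1 := by
      have : (ρ * K) ^ 2 ≤ 1 := by
        rw [mul_pow]
        calc ρ ^ 2 * K ^ 2 ≤ ρ ^ 2 * m := by gcongr
          _ ≤ 1 := hρm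
      exact (sq_le_one_iff₀ (by positivity)).1 this
    rw [le_div_iff₀ hK0, ← div_eq_mul_inv, le_div_iff₀ hm]
    calc ρ ^ 7 * K * m = ρ ^ 4 * ((ρ * K) * (ρ ^ 2 * m)) := by ring
      _ ≤ ρ ^ 4 * (1 * 1) := by gcongr
      _ = ρ ^ 4 := by ring

theorem norm_invSqrt_pow_four (hK : 1 ≤ K) (hξ : ξ ∈ rightRegion K) :
    ‖invSqrt ξ‖ ^ 4 = (‖ξ‖ ^ 2)⁻¹ := by
  have hξ0 : ξ ≠ 0 := norm_pos_iff.1 (by linarith [one_le_norm_of_mem hK hξ])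
  rw [show ‖invSqrt ξ‖ ^ 4 = (‖invSqrt ξ‖ ^ 2) ^ 2 by ring, norm_invSqrt_sq hξ0, inv_pow]

theorem norm_forcing_le (hK : 1 ≤ K) {W : ℂ → ℂ} (hξ : ξ ∈ rightRegion K)
    (hW : ‖W ξ‖ ≤ (rightDist ξ ^ 2)⁻¹) :
    ‖forcing A B C W ξ‖ ≤ (‖A‖ + ‖B‖ + ‖C‖) / K * (rightDist ξ)⁻¹ * (‖ξ‖ ^ 2)⁻¹ := by
  obtain ⟨h1, h2, h3⟩ := region_bounds hK hξ
  rw [← norm_invSqrt_pow_four hK hξ]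
  unfold forcing
  refine (norm_add₃_le).trans ?_
  simp only [norm_mul, norm_pow]
  calc ‖A‖ * ‖invSqrt ξ‖ ^ 4 * ‖W ξ‖ + ‖B‖ * ‖invSqrt ξ‖ * ‖W ξ‖ ^ 2 + ‖C‖ * ‖invSqrt ξ‖ ^ 7
      ≤ ‖A‖ * ‖invSqrt ξ‖ ^ 4 * (rightDist ξ ^ 2)⁻¹ +
        ‖B‖ * ‖invSqrt ξ‖ * ((rightDist ξ ^ 2)⁻¹) ^ 2 + ‖C‖ * ‖invSqrt ξ‖ ^ 7 := by gcongr
    _ = ‖A‖ * (‖invSqrt ξ‖ ^ 4 * (rightDist ξ ^ 2)⁻¹) +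
        ‖B‖ * (‖invSqrt ξ‖ * ((rightDist ξ ^ 2)⁻¹) ^ 2) + ‖C‖ * ‖invSqrt ξ‖ ^ 7 := by ring
    _ ≤ ‖A‖ * (‖invSqrt ξ‖ ^ 4 * (rightDist ξ)⁻¹ / K) +
        ‖B‖ * (‖invSqrt ξ‖ ^ 4 * (rightDist ξ)⁻¹ / K) +
        ‖C‖ * (‖invSqrt ξ‖ ^ 4 * (rightDist ξ)⁻¹ / K) := by gcongr
    _ = _ := by ring

theorem norm_forcing_sub_le (hK : 1 ≤ K) {V W : ℂ → ℂ} {d : ℝ} (hξ : ξ ∈ rightRegion K)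
    (hV : ‖V ξ‖ ≤ (rightDist ξ ^ 2)⁻¹) (hW : ‖W ξ‖ ≤ (rightDist ξ ^ 2)⁻¹)
    (hVW : ‖V ξ - W ξ‖ ≤ d * (rightDist ξ ^ 2)⁻¹) :
    ‖forcing A B C V ξ - forcing A B C W ξ‖ ≤
      2 * d * (‖A‖ + ‖B‖ + ‖C‖) / K * (rightDist ξ)⁻¹ * (‖ξ‖ ^ 2)⁻¹ := by
  obtain ⟨h1, h2, h3⟩ := region_bounds hK hξ
  have hm := rightDist_pos hξ
  have hd : 0 ≤ d := by
    by_contra! hd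
    have := mul_neg_of_neg_of_pos hd (show 0 < (rightDist ξ ^ 2)⁻¹ by positivity)
    linarith [norm_nonneg (V ξ - W ξ)]
  have hK0 : 0 < K := by linarith
  have hC : 0 ≤ 2 * d * (‖C‖ * (‖invSqrt ξ‖ ^ 4 * (rightDist ξ)⁻¹ / K)) := by positivity
  have hA : 0 ≤ d * (‖A‖ * (‖invSqrt ξ‖ ^ 4 * (rightDist ξ)⁻¹ / K)) := by positivity
  rw [← norm_invSqrt_pow_four hK hξ]
  have e : forcing A B C V ξ - forcing A B C W ξ =
      A * invSqrt ξ ^ 4 * (V ξ - W ξ) + B * invSqrt ξ * ((V ξ + W ξ) * (V ξ - W ξ)) := by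
    unfold forcing; ring
  have hs : ‖V ξ + W ξ‖ ≤ 2 * (rightDist ξ ^ 2)⁻¹ := (norm_add_le _ _).trans (by linarith)
  rw [e]
  refine (norm_add_le _ _).trans ?_
  simp only [norm_mul, norm_pow]
  calc ‖A‖ * ‖invSqrt ξ‖ ^ 4 * ‖V ξ - W ξ‖ +
        ‖B‖ * ‖invSqrt ξ‖ * (‖V ξ + W ξ‖ * ‖V ξ - W ξ‖)
      ≤ ‖A‖ * ‖invSqrt ξ‖ ^ 4 * (d * (rightDist ξ ^ 2)⁻¹) +
        ‖B‖ * ‖invSqrt ξ‖ * ((2 * (rightDist ξ ^ 2)⁻¹) * (d * (rightDist ξ ^ 2)⁻¹)) := by gcongr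
    _ = d * (‖A‖ * (‖invSqrt ξ‖ ^ 4 * (rightDist ξ ^ 2)⁻¹)) +
        2 * d * (‖B‖ * (‖invSqrt ξ‖ * ((rightDist ξ ^ 2)⁻¹) ^ 2)) := by ring
    _ ≤ d * (‖A‖ * (‖invSqrt ξ‖ ^ 4 * (rightDist ξ)⁻¹ / K)) +
        2 * d * (‖B‖ * (‖invSqrt ξ‖ ^ 4 * (rightDist ξ)⁻¹ / K)) := by gcongr
    _ ≤ 2 * d * (‖A‖ * (‖invSqrt ξ‖ ^ 4 * (rightDist ξ)⁻¹ / K)) +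
        2 * d * (‖B‖ * (‖invSqrt ξ‖ ^ 4 * (rightDist ξ)⁻¹ / K)) +
        2 * d * (‖C‖ * (‖invSqrt ξ‖ ^ 4 * (rightDist ξ)⁻¹ / K)) := by linarith
    _ = _ := by ring

/-- The functions among which the integral equation is solved. -/
def IsSmall (K : ℝ) (W : ℂ → ℂ) : Prop :=
  DifferentiableOn ℂ W (rightRegion K) ∧ ∀ ξ ∈ rightRegion K, ‖W ξ‖ ≤ (rightDist ξ ^ 2)⁻¹

theorem inv_rightDist_le_one (hK : 1 ≤ K) (hξ : ξ ∈ rightRegion K) : (rightDist ξ)⁻¹ ≤ 1 :=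
  inv_le_one_of_one_le₀ (by nlinarith [sq_lt_rightDist hξ])

theorem IsSmall.differentiableOn_forcing {W : ℂ → ℂ} (hW : IsSmall K W) :
    DifferentiableOn ℂ (forcing A B C W) (rightRegion K) := by
  have h := differentiableOn_invSqrt K
  have hW1 := hW.1
  unfold forcing
  fun_prop

theorem IsSmall.norm_forcing_le {W : ℂ → ℂ} (hK : 1 ≤ K) (hW : IsSmall K W) :
    ∀ ξ ∈ rightRegion K, ‖forcing A B C W ξ‖ ≤ (‖A‖ + ‖B‖ + ‖C‖) / K * (‖ξ‖ ^ 2)⁻¹ := by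
  intro ξ hξ
  refine (_root_.norm_forcing_le hK hξ (hW.2 ξ hξ)).trans ?_
  have := inv_rightDist_le_one hK hξ
  have hK0 : 0 < K := by linarith
  gcongr
  exact mul_le_of_le_one_right (by positivity) this

/-- The integral operator whose fixed points solve `W'' + W = forcing A B C W`. -/
def picard (A B C : ℂ) (W : ℂ → ℂ) : ℂ → ℂ := rightIntegral Real.sin (forcing A B C W)

theorem norm_sin_mul_le (s : ℝ) (w : ℂ) : ‖((Real.sin s : ℝ) : ℂ) * w‖ ≤ ‖w‖ := by
  rw [norm_mul, Complex.norm_real, Real.norm_eq_abs]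
  exact mul_le_of_le_one_left (norm_nonneg _) (Real.abs_sin_le_one s)

theorem IsSmall.picard (hK : 1 ≤ K) (hKL : 4 * Real.pi * (‖A‖ + ‖B‖ + ‖C‖) ≤ K) {W : ℂ → ℂ}
    (hW : IsSmall K W) : IsSmall K (picard A B C W) := by
  have hK0 : 0 < K := by linarith
  refine ⟨(rightIntegral_sin hK (by positivity) hW.differentiableOn_forcing
    (hW.norm_forcing_le hK)).1, fun ξ hξ => ?_⟩
  have hm := rightDist_pos hξ
  refine (norm_integral_Ioi_le (K := K)
    (D := (‖A‖ + ‖B‖ + ‖C‖) / K * (rightDist ξ)⁻¹) (by positivity) hξ fun s hs => ?_).trans ?_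
  · refine (norm_sin_mul_le s _).trans ((_root_.norm_forcing_le hK (add_mem_rightRegion hξ hs.le)
      (hW.2 _ (add_mem_rightRegion hξ hs.le))).trans ?_)
    gcongr
    exact rightDist_le_add ξ hs.le
  · have : (‖A‖ + ‖B‖ + ‖C‖) / K * Real.pi ≤ 1 := by
      rw [div_mul_eq_mul_div, div_le_one hK0]
      nlinarith [Real.pi_pos, norm_nonneg A, norm_nonneg B, norm_nonneg C]
    calc (‖A‖ + ‖B‖ + ‖C‖) / K * (rightDist ξ)⁻¹ * (Real.pi / rightDist ξ)
        = ((‖A‖ + ‖B‖ + ‖C‖) / K * Real.pi) * (rightDist ξ ^ 2)⁻¹ := by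
          field_simp
      _ ≤ 1 * (rightDist ξ ^ 2)⁻¹ := by gcongr
      _ = _ := one_mul _

theorem norm_picard_sub_le (hK : 1 ≤ K) (hKL : 4 * Real.pi * (‖A‖ + ‖B‖ + ‖C‖) ≤ K)
    {V W : ℂ → ℂ} (hV : IsSmall K V) (hW : IsSmall K W) {d : ℝ} (hd : 0 ≤ d)
    (hVW : ∀ ξ ∈ rightRegion K, ‖V ξ - W ξ‖ ≤ d * (rightDist ξ ^ 2)⁻¹) (hξ : ξ ∈ rightRegion K) :
    ‖picard A B C V ξ - picard A B C W ξ‖ ≤ d / 2 * (rightDist ξ ^ 2)⁻¹ := by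
  have hK0 : 0 < K := by linarith
  have hm := rightDist_pos hξ
  have hint : ∀ {W : ℂ → ℂ}, IsSmall K W → MeasureTheory.IntegrableOn
      (fun s : ℝ => ((Real.sin s : ℝ) : ℂ) * forcing A B C W (ξ + s)) (Set.Ioi 0) := by
    intro W hW
    refine ((integrable_inv_one_add_sq.const_mul ((‖A‖ + ‖B‖ + ‖C‖) / K *
      (1 + (1 + ‖ξ‖) ^ 2))).integrableOn (s := Set.Ioi 0)).mono' ?_ ?_
    · exact ((Complex.continuous_ofReal.comp Real.continuous_sin).continuousOn.mul
        (continuousOn_comp_add hW.differentiableOn_forcing.continuousOn hξ)).aestronglyMeasurable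
        measurableSet_Ioi
    · filter_upwards [MeasureTheory.ae_restrict_mem measurableSet_Ioi] with s hs
      have hs0 : 0 ≤ s := le_of_lt hs
      refine (norm_sin_mul_le s _).trans
        ((hW.norm_forcing_le hK _ (add_mem_rightRegion hξ hs0)).trans ?_)
      rw [mul_assoc]
      gcongr
      exact inv_norm_add_sq_le hK hξ hs0
  have e : picard A B C V ξ - picard A B C W ξ = ∫ s in Set.Ioi (0 : ℝ),
      ((Real.sin s : ℝ) : ℂ) * (forcing A B C V (ξ + s) - forcing A B C W (ξ + s)) := by
    simp only [picard, rightIntegral]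
    rw [← MeasureTheory.integral_sub (hint hV) (hint hW)]
    simp only [mul_sub]
  rw [e]
  refine (norm_integral_Ioi_le (K := K)
    (D := 2 * d * (‖A‖ + ‖B‖ + ‖C‖) / K * (rightDist ξ)⁻¹) (by positivity) hξ
    fun s hs => ?_).trans ?_
  · have hmem := add_mem_rightRegion hξ hs.le
    refine (norm_sin_mul_le s _).trans ((norm_forcing_sub_le hK hmem
      (hV.2 _ hmem) (hW.2 _ hmem) (hVW _ hmem)).trans ?_)
    gcongr
    exact rightDist_le_add ξ hs.le
  · have : 2 * (‖A‖ + ‖B‖ + ‖C‖) / K * Real.pi ≤ 1 / 2 := by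
      rw [div_mul_eq_mul_div, div_le_iff₀ hK0]
      linarith
    calc 2 * d * (‖A‖ + ‖B‖ + ‖C‖) / K * (rightDist ξ)⁻¹ * (Real.pi / rightDist ξ)
        = d * (2 * (‖A‖ + ‖B‖ + ‖C‖) / K * Real.pi) * (rightDist ξ ^ 2)⁻¹ := by
          field_simp
      _ ≤ d * (1 / 2) * (rightDist ξ ^ 2)⁻¹ := by gcongr
      _ = _ := by ring

/-- On the functions that are small for `K`, the operator `picard` is a contraction with factor
`1/2` in the norm weighted by `rightDist ^ 2`. -/
theorem exists_picard_fixedPoint (hK : 1 ≤ K) (hKL : 4 * Real.pi * (‖A‖ + ‖B‖ + ‖C‖) ≤ K) :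
    ∃ W : ℂ → ℂ, IsSmall K W ∧ ∀ ξ ∈ rightRegion K, W ξ = picard A B C W ξ := by
  set w : ℕ → ℂ → ℂ := fun n => (picard A B C)^[n] 0 with hw
  have hsucc : ∀ n, w (n + 1) = picard A B C (w n) := fun n => Function.iterate_succ_apply' _ _ _
  have hsmall : ∀ n, IsSmall K (w n) := by
    intro n
    induction n with
    | zero =>
      refine ⟨differentiableOn_const 0, fun ξ hξ => ?_⟩
      have h0 : w 0 ξ = 0 := rfl
      rw [h0, norm_zero]
      positivity
    | succ n ih => rw [hsucc]; exact ih.picard hK hKL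
  have hstep : ∀ n, ∀ ξ ∈ rightRegion K,
      ‖w (n + 1) ξ - w n ξ‖ ≤ (1 / 2) ^ n * (rightDist ξ ^ 2)⁻¹ := by
    intro n
    induction n with
    | zero => intro ξ hξ; simpa [hw] using (hsmall 1).2 ξ hξ
    | succ n ih =>
      intro ξ hξ
      rw [hsucc (n + 1), hsucc n]
      refine (norm_picard_sub_le hK hKL (hsucc n ▸ hsmall (n + 1)) (hsmall n)
        (by positivity) (hsucc n ▸ ih) hξ).trans (le_of_eq ?_)
      rw [pow_succ]; ring
  have hdist : ∀ ξ ∈ rightRegion K, ∀ n, dist (w n ξ) (w (n + 1) ξ) ≤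
      (rightDist ξ ^ 2)⁻¹ * (1 / 2) ^ n := by
    intro ξ hξ n
    rw [dist_comm, dist_eq_norm, mul_comm]
    exact hstep n ξ hξ
  have hlim : ∀ ξ, ∃ l : ℂ, ξ ∈ rightRegion K → Tendsto (fun n => w n ξ) atTop (𝓝 l) := by
    intro ξ
    by_cases hξ : ξ ∈ rightRegion K
    · obtain ⟨l, hl⟩ := cauchySeq_tendsto_of_complete
        (cauchySeq_of_le_geometric _ _ (by norm_num) (hdist ξ hξ))
      exact ⟨l, fun _ => hl⟩
    · exact ⟨0, fun h => absurd h hξ⟩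
  choose W hW using hlim
  have hrate : ∀ n, ∀ ξ ∈ rightRegion K, ‖w n ξ - W ξ‖ ≤
      2 * (1 / 2) ^ n * (rightDist ξ ^ 2)⁻¹ := by
    intro n ξ hξ
    have := dist_le_of_le_geometric_of_tendsto _ _ (by norm_num) (hdist ξ hξ) (hW ξ hξ) n
    rw [dist_eq_norm] at this
    refine this.trans (le_of_eq ?_)
    ring
  have hpow : Tendsto (fun n : ℕ => 2 * (1 / 2 : ℝ) ^ n) atTop (𝓝 0) := by
    simpa using (tendsto_pow_atTop_nhds_zero_of_lt_one (r := (1 / 2 : ℝ)) (by norm_num)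
      (by norm_num)).const_mul 2
  have hunif : TendstoUniformlyOn w W atTop (rightRegion K) := by
    rw [Metric.tendstoUniformlyOn_iff]
    intro ε hε
    filter_upwards [hpow.eventually_lt_const hε] with n hn ξ hξ
    rw [dist_comm, dist_eq_norm]
    refine (hrate n ξ hξ).trans_lt (lt_of_le_of_lt ?_ hn)
    refine mul_le_of_le_one_right (by positivity) ?_
    rw [← inv_pow]
    exact pow_le_one₀ (inv_nonneg.2 (rightDist_nonneg ξ)) (inv_rightDist_le_one hK hξ)
  have hWs : IsSmall K W :=
    ⟨hunif.tendstoLocallyUniformlyOn.differentiableOn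
      (Eventually.of_forall fun n => (hsmall n).1) (isOpen_rightRegion K),
      fun ξ hξ => le_of_tendsto (hW ξ hξ).norm (Eventually.of_forall fun n => (hsmall n).2 ξ hξ)⟩
  refine ⟨W, hWs, fun ξ hξ => ?_⟩
  refine tendsto_nhds_unique ((hW ξ hξ).comp (tendsto_add_atTop_nat 1)) ?_
  rw [tendsto_iff_norm_sub_tendsto_zero]
  have h0 := (hpow.div_const 2).mul_const (rightDist ξ ^ 2)⁻¹
  rw [zero_div, zero_mul] at h0
  refine squeeze_zero (fun n => norm_nonneg _) (fun n => ?_) h0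
  simp only [Function.comp_apply, hsucc]
  exact norm_picard_sub_le hK hKL (hsmall n) hWs (by positivity) (hrate n) hξ

end picard

/-- Solutions of the normalized equation which are small in a region containing, near infinity,
every closed subsector of the plane cut along the negative half-line. -/
theorem exists_small_solution (A B C : ℂ) : ∃ (K : ℝ) (W : ℂ → ℂ), 1 ≤ K ∧ IsSmall K W ∧
    ∀ ξ ∈ rightRegion K, deriv (deriv W) ξ + W ξ = forcing A B C W ξ := by
  set K := max 1 (4 * Real.pi * (‖A‖ + ‖B‖ + ‖C‖)) with hKdef
  have hK : 1 ≤ K := le_max_left _ _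
  have hK0 : 0 < K := by linarith
  obtain ⟨W, hW, hfix⟩ := exists_picard_fixedPoint (A := A) (B := B) (C := C) hK
    (le_max_right _ _)
  refine ⟨K, W, hK, hW, fun ξ hξ => ?_⟩
  have e : W =ᶠ[𝓝 ξ] rightIntegral Real.sin (forcing A B C W) := by
    filter_upwards [(isOpen_rightRegion K).mem_nhds hξ] with ζ hζ using hfix ζ hζ
  rw [e.deriv.deriv_eq, (rightIntegral_sin hK (by positivity) hW.differentiableOn_forcing
    (hW.norm_forcing_le hK)).2 ξ hξ, ← e.eq_of_nhds]
  ring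

/-! ### Existence of the tritronquée solution -/

/-- In the sector `|arg ξ| ≤ π - δ` the quantity `rightDist ξ` is comparable to `‖ξ‖`. -/
theorem sin_mul_norm_le_rightDist {ξ : ℂ} {δ : ℝ} (hδ0 : 0 < δ) (hδ : δ ≤ Real.pi / 2)
    (h : |ξ.arg| ≤ Real.pi - δ) : Real.sin δ * ‖ξ‖ ≤ rightDist ξ := by
  have hs1 := Real.sin_le_one δ
  have hs0 : 0 ≤ Real.sin δ := Real.sin_nonneg_of_nonneg_of_le_pi hδ0.le (by linarith)
  refine le_of_sq_le_sq ?_ (rightDist_nonneg ξ)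
  rw [rightDist_sq]
  rcases le_or_gt 0 ξ.re with hre | hre
  · rw [max_eq_left hre, mul_pow, Complex.sq_norm, Complex.normSq_apply]
    have : Real.sin δ ^ 2 ≤ 1 := pow_le_one₀ hs0 hs1
    nlinarith [sq_nonneg ξ.re, sq_nonneg ξ.im]
  · have harg : Real.pi / 2 < |ξ.arg| := by
      by_contra! hc
      exact absurd (Complex.abs_arg_le_pi_div_two_iff.1 hc) (not_le.2 hre)
    have hsin : Real.sin δ ≤ Real.sin |ξ.arg| := by
      rw [← Real.sin_pi_sub |ξ.arg|]
      exact Real.sin_le_sin_of_le_of_le_pi_div_two (by linarith) (by linarith) (by linarith)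
    have him : ξ.im ^ 2 = (Real.sin |ξ.arg| * ‖ξ‖) ^ 2 := by
      have hi := Complex.norm_mul_sin_arg ξ
      rcases abs_choice ξ.arg with h | h
      · rw [h, ← hi]; ring
      · rw [h, Real.sin_neg, ← hi]; ring
    rw [max_eq_right hre.le, him]
    have := mul_le_mul_of_nonneg_right hsin (norm_nonneg ξ)
    have h0 : 0 ≤ Real.sin δ * ‖ξ‖ := by positivity
    nlinarith

/-- `z^(1/8)`, in terms of which every function in the WKB normalization is a monomial. -/
def eighthRoot (z : ℂ) : ℂ := Complex.exp (Complex.log z / 8)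

/-- `√(1/6)`. -/
def sqrtSixth : ℂ := Complex.exp ((Real.log (1 / 6) : ℝ) / 2)

/-- A logarithm of the constant `λ` in `ξ = λ z^(5/4)`, where `λ² = -(192/25) i √(1/6)`. -/
def logScale : ℂ :=
  ((Real.log (192 / 25) + Real.log (1 / 6) / 2) / 2 : ℝ) - Real.pi / 4 * Complex.I

/-- The WKB variable `ξ = λ z^(5/4)`; the linearized equation has solutions close to
`z^(-1/8) e^{±iξ}`. -/
def wkbVar (z : ℂ) : ℂ := Complex.exp (5 / 4 * Complex.log z + logScale)

theorem eighthRoot_ne_zero (z : ℂ) : eighthRoot z ≠ 0 := Complex.exp_ne_zero _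

theorem eighthRoot_pow {z : ℂ} (hz : z ≠ 0) : eighthRoot z ^ 8 = z := by
  rw [eighthRoot, ← Complex.exp_nat_mul,
    show ((8 : ℕ) : ℂ) * (Complex.log z / 8) = Complex.log z by push_cast; ring,
    Complex.exp_log hz]

theorem sqrtSixth_ne_zero : sqrtSixth ≠ 0 := Complex.exp_ne_zero _

theorem sqrtSixth_sq : sqrtSixth ^ 2 = 1 / 6 := by
  rw [sqrtSixth, ← Complex.exp_nat_mul,
    show ((2 : ℕ) : ℂ) * (((Real.log (1 / 6) : ℝ) : ℂ) / 2) = ((Real.log (1 / 6) : ℝ) : ℂ) by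
      push_cast; ring,
    ← Complex.ofReal_exp, Real.exp_log (by norm_num)]
  push_cast; rfl

theorem exp_logScale_sq :
    Complex.exp logScale ^ 2 = -(192 / 25) * Complex.I * sqrtSixth := by
  have e : ((2 : ℕ) : ℂ) * logScale = ((Real.log (192 / 25) : ℝ) : ℂ) +
      ((Real.log (1 / 6) : ℝ) : ℂ) / 2 + -(Real.pi / 2 * Complex.I) := by
    unfold logScale; push_cast; ring
  rw [← Complex.exp_nat_mul, e, Complex.exp_add, Complex.exp_add, Complex.exp_neg,
    Complex.exp_pi_div_two_mul_I, Complex.inv_I, ← Complex.ofReal_exp,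
    Real.exp_log (by norm_num), sqrtSixth]
  push_cast; ring

theorem wkbVar_eq (z : ℂ) : wkbVar z = Complex.exp logScale * eighthRoot z ^ 10 := by
  rw [wkbVar, eighthRoot, ← Complex.exp_nat_mul, ← Complex.exp_add]
  congr 1; push_cast; ring

theorem logScale_im : logScale.im = -(Real.pi / 4) := by
  unfold logScale
  rw [Complex.sub_im, Complex.ofReal_im,
    show (Real.pi : ℂ) / 4 * Complex.I = ((Real.pi / 4 : ℝ) : ℂ) * Complex.I by push_cast; rfl]
  simp

theorem log_wkbVar {z : ℂ} (h1 : -(3 * Real.pi / 5) < z.arg) (h2 : z.arg < Real.pi) :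
    Complex.log (wkbVar z) = 5 / 4 * Complex.log z + logScale := by
  have him : (5 / 4 * Complex.log z + logScale).im = 5 / 4 * z.arg - Real.pi / 4 := by
    rw [Complex.add_im, logScale_im, show (5 / 4 : ℂ) = ((5 / 4 : ℝ) : ℂ) by push_cast; rfl,
      Complex.im_ofReal_mul, Complex.log_im]
    ring
  apply Complex.log_exp <;> rw [him] <;> linarith

theorem arg_wkbVar {z : ℂ} (h1 : -(3 * Real.pi / 5) < z.arg) (h2 : z.arg < Real.pi) :
    (wkbVar z).arg = 5 / 4 * z.arg - Real.pi / 4 := by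
  rw [← Complex.log_im, log_wkbVar h1 h2, Complex.add_im, logScale_im,
    show (5 / 4 : ℂ) = ((5 / 4 : ℝ) : ℂ) by push_cast; rfl, Complex.im_ofReal_mul, Complex.log_im]
  ring

theorem invSqrt_wkbVar {z : ℂ} (h1 : -(3 * Real.pi / 5) < z.arg) (h2 : z.arg < Real.pi) :
    Complex.exp (logScale / 2) * invSqrt (wkbVar z) = (eighthRoot z ^ 5)⁻¹ := by
  rw [invSqrt, log_wkbVar h1 h2, eighthRoot, ← Complex.exp_nat_mul, ← Complex.exp_neg,
    ← Complex.exp_add]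
  congr 1; push_cast; ring

theorem sqrt_div_six {z : ℂ} (hz : z ≠ 0) :
    (z / 6) ^ (1 / 2 : ℂ) = sqrtSixth * eighthRoot z ^ 4 := by
  have h6 : z / 6 = ((1 / 6 : ℝ) : ℂ) * z := by push_cast; ring
  rw [Complex.cpow_def_of_ne_zero (div_ne_zero hz (by norm_num)), h6,
    Complex.log_ofReal_mul (by norm_num) hz, sqrtSixth, eighthRoot, ← Complex.exp_nat_mul,
    ← Complex.exp_add]
  congr 1; push_cast; ring

theorem hasDerivAt_eighthRoot_zpow {z : ℂ} (hz : z ∈ Complex.slitPlane) (n : ℤ) :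
    HasDerivAt (fun z => eighthRoot z ^ n) (n / 8 * eighthRoot z ^ (n - 8)) z := by
  have hz0 := Complex.slitPlane_ne_zero hz
  have h1 : HasDerivAt eighthRoot (eighthRoot z * (z⁻¹ / 8)) z :=
    ((Complex.hasDerivAt_log hz).div_const 8).cexp
  have h2 := (hasDerivAt_zpow n (eighthRoot z) (Or.inl (eighthRoot_ne_zero z))).comp z h1
  refine h2.congr_deriv ?_
  have hp := eighthRoot_ne_zero z
  have h3 : z⁻¹ = eighthRoot z ^ (-8 : ℤ) := by
    rw [zpow_neg]; congr 1; exact_mod_cast (eighthRoot_pow hz0).symm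
  rw [h3, show (n : ℤ) - 8 = (n - 1) + 1 + -8 by ring, zpow_add₀ hp, zpow_add₀ hp, zpow_one]
  ring

/-- The solution in terms of a solution `W` of the normalized equation: two terms of the formal
expansion and a WKB-normalized remainder. -/
def ofNormalized (W : ℂ → ℂ) (z : ℂ) : ℂ :=
  Complex.I * sqrtSixth * eighthRoot z ^ (4 : ℤ) - 1 / 48 * eighthRoot z ^ (-16 : ℤ) +
    eighthRoot z ^ (-1 : ℤ) * W (wkbVar z)

/-- The part of the sector that `wkbVar` maps into `rightRegion K`. -/
def wkbDomain (K : ℝ) : Set ℂ :=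
  {z | z ∈ Complex.slitPlane ∧ -(3 * Real.pi / 5) < z.arg ∧ wkbVar z ∈ rightRegion K}

theorem isOpen_wkbDomain (K : ℝ) : IsOpen (wkbDomain K) := by
  have hlog : ContinuousOn Complex.log Complex.slitPlane := fun z hz =>
    (Complex.differentiableAt_log hz).continuousAt.continuousWithinAt
  have hT : IsOpen {w : ℂ | -(3 * Real.pi / 5) < w.im ∧
      Complex.exp (5 / 4 * w + logScale) ∈ rightRegion K} :=
    (isOpen_lt continuous_const Complex.continuous_im).inter
      ((isOpen_rightRegion K).preimage (by fun_prop))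
  convert hlog.isOpen_inter_preimage Complex.isOpen_slitPlane hT using 1
  ext z
  simp [wkbDomain, Complex.log_im, wkbVar]
  tauto

theorem arg_lt_pi_of_mem_slitPlane {z : ℂ} (hz : z ∈ Complex.slitPlane) : z.arg < Real.pi :=
  lt_of_le_of_ne (Complex.arg_le_pi z) (Complex.mem_slitPlane_iff_arg.1 hz).1

/-- If `W` solves `W'' + W = forcing`, with the constants coming from the normalization, then
`ofNormalized W` solves `y'' = 6 y ^ 2 + z`. -/
theorem ofNormalized_solves {K : ℝ} {W : ℂ → ℂ} (hW : DifferentiableOn ℂ W (rightRegion K))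
    (hode : ∀ ξ ∈ rightRegion K, deriv (deriv W) ξ + W ξ = forcing
      (25 / 64 * Complex.exp (logScale / 2) ^ 4 / (12 * Complex.I * sqrtSixth))
      (-6 * Complex.exp (logScale / 2) / (12 * Complex.I * sqrtSixth))
      (-(49 / 384) * Complex.exp (logScale / 2) ^ 7 / (12 * Complex.I * sqrtSixth)) W ξ) :
    DifferentiableOn ℂ (ofNormalized W) (wkbDomain K) ∧ ∀ z ∈ wkbDomain K,
      deriv (deriv (ofNormalized W)) z = 6 * ofNormalized W z ^ 2 + z := by
  have hopen := isOpen_rightRegion K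
  set lam := Complex.exp logScale with hlam
  have hvar : ∀ z ∈ wkbDomain K, HasDerivAt wkbVar (5 / 4 * lam * eighthRoot z ^ (2 : ℤ)) z := by
    intro z hz
    have h := (hasDerivAt_eighthRoot_zpow hz.1 10).const_mul lam
    have e : wkbVar = fun z => lam * eighthRoot z ^ (10 : ℤ) := by
      funext z; rw [wkbVar_eq]; norm_cast
    rw [e]
    refine h.congr_deriv ?_
    push_cast
    ring
  have hW0 : ∀ z ∈ wkbDomain K, HasDerivAt (fun z => W (wkbVar z))
      (deriv W (wkbVar z) * (5 / 4 * lam * eighthRoot z ^ (2 : ℤ))) z := fun z hz =>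
    (hW.differentiableAt (hopen.mem_nhds hz.2.2)).hasDerivAt.comp z (hvar z hz)
  have hW1 : ∀ z ∈ wkbDomain K, HasDerivAt (fun z => deriv W (wkbVar z))
      (deriv (deriv W) (wkbVar z) * (5 / 4 * lam * eighthRoot z ^ (2 : ℤ))) z := fun z hz =>
    ((hW.deriv hopen).differentiableAt (hopen.mem_nhds hz.2.2)).hasDerivAt.comp z (hvar z hz)
  have hd1 : ∀ z ∈ wkbDomain K, HasDerivAt (ofNormalized W)
      (Complex.I * sqrtSixth / 2 * eighthRoot z ^ (-4 : ℤ) + 1 / 24 * eighthRoot z ^ (-24 : ℤ)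
        - 1 / 8 * eighthRoot z ^ (-9 : ℤ) * W (wkbVar z)
        + 5 / 4 * lam * (eighthRoot z ^ (1 : ℤ) * deriv W (wkbVar z))) z := by
    intro z hz
    have h := (((hasDerivAt_eighthRoot_zpow hz.1 4).const_mul (Complex.I * sqrtSixth)).sub
      ((hasDerivAt_eighthRoot_zpow hz.1 (-16)).const_mul (1 / 48))).add
      ((hasDerivAt_eighthRoot_zpow hz.1 (-1)).mul (hW0 z hz))
    refine h.congr_deriv ?_
    have hp := eighthRoot_ne_zero z
    push_cast
    have e1 : eighthRoot z ^ (1 : ℤ) = eighthRoot z ^ (-1 : ℤ) * eighthRoot z ^ (2 : ℤ) := by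
      rw [← zpow_add₀ hp]; norm_num
    rw [e1]
    ring
  have hd2 : ∀ z ∈ wkbDomain K, HasDerivAt (fun z =>
      Complex.I * sqrtSixth / 2 * eighthRoot z ^ (-4 : ℤ) + 1 / 24 * eighthRoot z ^ (-24 : ℤ)
        - 1 / 8 * eighthRoot z ^ (-9 : ℤ) * W (wkbVar z)
        + 5 / 4 * lam * (eighthRoot z ^ (1 : ℤ) * deriv W (wkbVar z)))
      (-(Complex.I * sqrtSixth) / 4 * eighthRoot z ^ (-12 : ℤ)
        - 1 / 8 * eighthRoot z ^ (-32 : ℤ) + 9 / 64 * eighthRoot z ^ (-17 : ℤ) * W (wkbVar z)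
        + 25 / 16 * lam ^ 2 * eighthRoot z ^ (3 : ℤ) * deriv (deriv W) (wkbVar z)) z := by
    intro z hz
    have h := ((((hasDerivAt_eighthRoot_zpow hz.1 (-4)).const_mul (Complex.I * sqrtSixth / 2)).add
      ((hasDerivAt_eighthRoot_zpow hz.1 (-24)).const_mul (1 / 24))).sub
      (((hasDerivAt_eighthRoot_zpow hz.1 (-9)).const_mul (1 / 8)).mul (hW0 z hz))).add
      (((hasDerivAt_eighthRoot_zpow hz.1 1).mul (hW1 z hz)).const_mul (5 / 4 * lam))
    refine h.congr_deriv ?_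
    have hp := eighthRoot_ne_zero z
    push_cast
    have e1 : eighthRoot z ^ (3 : ℤ) = eighthRoot z ^ (1 : ℤ) * eighthRoot z ^ (2 : ℤ) := by
      rw [← zpow_add₀ hp]; norm_num
    -- the first-order terms cancel: this is the purpose of the factor `z^(-1/8)`
    have e2 : eighthRoot z ^ (-7 : ℤ) = eighthRoot z ^ (-9 : ℤ) * eighthRoot z ^ (2 : ℤ) := by
      rw [← zpow_add₀ hp]; norm_num
    rw [e1, e2]
    ring
  refine ⟨fun z hz => (hd1 z hz).differentiableAt.differentiableWithinAt, fun z hz => ?_⟩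
  have e : deriv (ofNormalized W) =ᶠ[𝓝 z] fun z =>
      Complex.I * sqrtSixth / 2 * eighthRoot z ^ (-4 : ℤ) + 1 / 24 * eighthRoot z ^ (-24 : ℤ)
        - 1 / 8 * eighthRoot z ^ (-9 : ℤ) * W (wkbVar z)
        + 5 / 4 * lam * (eighthRoot z ^ (1 : ℤ) * deriv W (wkbVar z)) := by
    filter_upwards [(isOpen_wkbDomain K).mem_nhds hz] with w hw using (hd1 w hw).deriv
  rw [e.deriv_eq, (hd2 z hz).deriv]
  have hz0 := Complex.slitPlane_ne_zero hz.1
  have hp := eighthRoot_ne_zero z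
  have hode' := hode _ hz.2.2
  have hr := invSqrt_wkbVar hz.2.1 (arg_lt_pi_of_mem_slitPlane hz.1)
  have hlam2 : lam ^ 2 = -(192 / 25) * Complex.I * sqrtSixth := exp_logScale_sq
  have hs0 := sqrtSixth_ne_zero
  have hs2 := sqrtSixth_sq
  have hzp := eighthRoot_pow hz0
  unfold forcing at hode'
  unfold ofNormalized
  generalize eighthRoot z = p at *
  generalize W (wkbVar z) = w at *
  generalize invSqrt (wkbVar z) = r at *
  generalize Complex.exp (logScale / 2) = μ at *
  have hW2 : deriv (deriv W) (wkbVar z) =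
      (25 / 64 * (p ^ 5)⁻¹ ^ 4 * w - 6 * (p ^ 5)⁻¹ * w ^ 2 - 49 / 384 * (p ^ 5)⁻¹ ^ 7) /
        (12 * Complex.I * sqrtSixth) - w := by
    rw [← hr]
    linear_combination hode'
  have hI : Complex.I ^ 2 = -1 := Complex.I_sq
  have hI0 := Complex.I_ne_zero
  generalize Complex.I = i at *
  generalize sqrtSixth = a at *
  have hia : z = -6 * (i * a) ^ 2 * p ^ 8 := by rw [mul_pow, hI, hs2, hzp]; ring
  rw [hW2, hlam2, hia]
  have hz1 : ∀ n : ℕ, p ^ (-(n : ℤ)) = (p ^ n)⁻¹ := fun n => by rw [zpow_neg, zpow_natCast]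
  have hz4 : p ^ (4 : ℤ) = p ^ 4 := by norm_cast
  have hz3 : p ^ (3 : ℤ) = p ^ 3 := by norm_cast
  rw [show p ^ (-12 : ℤ) = (p ^ 12)⁻¹ from hz1 12, show p ^ (-32 : ℤ) = (p ^ 32)⁻¹ from hz1 32,
    show p ^ (-17 : ℤ) = (p ^ 17)⁻¹ from hz1 17, show p ^ (-16 : ℤ) = (p ^ 16)⁻¹ from hz1 16,
    show p ^ (-1 : ℤ) = (p ^ 1)⁻¹ from hz1 1, hz4, hz3]
  field_simp
  ring

theorem norm_wkbVar (z : ℂ) :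
    ‖wkbVar z‖ = ‖Complex.exp logScale‖ * ‖eighthRoot z‖ ^ 10 := by
  rw [wkbVar_eq, norm_mul, norm_pow]

/-- In a closed subsector, every point that is far enough out lies in `wkbDomain K`, and there the
distance in the definition of `rightRegion` is at least a multiple of the modulus. -/
theorem eventually_mem_wkbDomain (K : ℝ) {ε : ℝ} (hε : 0 < ε) :
    ∃ c : ℝ, 0 < c ∧ ∀ᶠ z in sectorAtInfinity ε, 1 ≤ ‖z‖ ∧ z ∈ wkbDomain K ∧
      c * ‖eighthRoot z‖ ^ 10 ≤ rightDist (wkbVar z) := by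
  have hpi := Real.pi_pos
  set δ := min (5 * ε / 4) (Real.pi / 2) with hδ
  have hδ0 : 0 < δ := lt_min (by linarith) (by linarith)
  have hδ2 : δ ≤ Real.pi / 2 := min_le_right _ _
  have hδ1 : δ ≤ 5 * ε / 4 := min_le_left _ _
  have hsin : 0 < Real.sin δ := Real.sin_pos_of_pos_of_lt_pi hδ0 (by linarith)
  set c := Real.sin δ * ‖Complex.exp logScale‖ with hc
  have hc0 : 0 < c := mul_pos hsin (norm_pos_iff.2 (Complex.exp_ne_zero _))
  refine ⟨c, hc0, ?_⟩
  rw [sectorAtInfinity, eventually_inf_principal, hasBasis_cobounded_norm.eventually_iff]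
  refine ⟨max 1 (((K ^ 2 * ‖Complex.exp logScale‖ + 1) / c ^ 2) ^ 8), trivial, fun z hz hsec => ?_⟩
  have hz1 : 1 ≤ ‖z‖ := (le_max_left _ _).trans hz
  have hz0 : z ≠ 0 := norm_pos_iff.1 (by linarith)
  obtain ⟨ha1, ha2⟩ := hsec
  have hzp : ‖eighthRoot z‖ ^ 8 = ‖z‖ := by rw [← norm_pow, eighthRoot_pow hz0]
  have hp1 : 1 ≤ ‖eighthRoot z‖ := by
    by_contra! h
    have := pow_lt_one₀ (norm_nonneg _) h (n := 8) (by norm_num)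
    linarith
  have hpK : (K ^ 2 * ‖Complex.exp logScale‖ + 1) / c ^ 2 ≤ ‖eighthRoot z‖ :=
    le_of_pow_le_pow_left₀ (n := 8) (by norm_num) (norm_nonneg _)
      (((le_max_right _ _).trans hz).trans_eq hzp.symm)
  have hlow : -(3 * Real.pi / 5) < z.arg := by linarith
  have hup : z.arg < Real.pi := by linarith
  have harg : |(wkbVar z).arg| ≤ Real.pi - δ := by
    rw [arg_wkbVar hlow hup, abs_le]
    constructor <;> linarith
  have hdist : c * ‖eighthRoot z‖ ^ 10 ≤ rightDist (wkbVar z) := by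
    have := sin_mul_norm_le_rightDist hδ0 hδ2 harg
    rwa [norm_wkbVar, ← mul_assoc] at this
  refine ⟨hz1, ⟨Complex.mem_slitPlane_iff_arg.2 ⟨hup.ne, hz0⟩, hlow, ?_⟩, hdist⟩
  have h1 : K ^ 2 * ‖Complex.exp logScale‖ < c ^ 2 * ‖eighthRoot z‖ := by
    rw [div_le_iff₀ (by positivity)] at hpK; linarith
  have h2 : ‖eighthRoot z‖ ≤ ‖eighthRoot z‖ ^ 10 := le_self_pow₀ hp1 (by norm_num)
  change K ^ 2 * ‖wkbVar z‖ < rightDist (wkbVar z) ^ 2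
  calc K ^ 2 * ‖wkbVar z‖
      = K ^ 2 * ‖Complex.exp logScale‖ * ‖eighthRoot z‖ ^ 10 := by rw [norm_wkbVar]; ring
    _ < c ^ 2 * ‖eighthRoot z‖ ^ 10 * ‖eighthRoot z‖ ^ 10 := by
        have : 0 < ‖eighthRoot z‖ ^ 10 := by positivity
        have h3 := mul_le_mul_of_nonneg_left h2 (sq_nonneg c)
        exact mul_lt_mul_of_pos_right (h1.trans_le h3) this
    _ = (c * ‖eighthRoot z‖ ^ 10) ^ 2 := by ring
    _ ≤ rightDist (wkbVar z) ^ 2 := by gcongr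

/-- Existence of a tritronquée solution.  Relative to the leading term, the second term of the
formal expansion has order `z^(-5/2)`, and the remainder `z^(-1/8) W(λ z^(5/4))` has order
`z^(-5/8) (z^(5/4))^(-2)`. -/
theorem exists_isTritronquee : ∃ y : ℂ → ℂ, IsTritronquee y := by
  obtain ⟨K, W, -, hW, hode⟩ := exists_small_solution
    (25 / 64 * Complex.exp (logScale / 2) ^ 4 / (12 * Complex.I * sqrtSixth))
    (-6 * Complex.exp (logScale / 2) / (12 * Complex.I * sqrtSixth))
    (-(49 / 384) * Complex.exp (logScale / 2) ^ 7 / (12 * Complex.I * sqrtSixth))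
  obtain ⟨hd, hp⟩ := ofNormalized_solves hW.1 hode
  refine ⟨ofNormalized W, fun ε hε => ?_, fun ε hε => ?_, fun ε hε => ?_⟩ <;>
    obtain ⟨c, hc, hev⟩ := eventually_mem_wkbDomain K hε
  · filter_upwards [hev] with z hz using
      hd.analyticAt ((isOpen_wkbDomain K).mem_nhds hz.2.1)
  · filter_upwards [hev] with z hz using hp z hz.2.1
  · refine Asymptotics.IsBigO.of_bound ((1 / 48 + (c ^ 2)⁻¹) / ‖sqrtSixth‖) ?_
    filter_upwards [hev] with z ⟨hz1, hz, hdist⟩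
    have hz0 : z ≠ 0 := norm_pos_iff.1 (by linarith)
    have hq := eighthRoot_ne_zero z
    have hzp : ‖eighthRoot z‖ ^ 8 = ‖z‖ := by rw [← norm_pow, eighthRoot_pow hz0]
    have hq1 : 1 ≤ ‖eighthRoot z‖ := by
      by_contra! h
      have := pow_lt_one₀ (norm_nonneg _) h (n := 8) (by norm_num)
      linarith
    have hrpow : ‖z‖ ^ (-(5 / 2) : ℝ) = (‖eighthRoot z‖ ^ 20)⁻¹ := by
      rw [← hzp, ← Real.rpow_natCast, ← Real.rpow_mul (norm_nonneg _), ← Real.rpow_natCast,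
        ← Real.rpow_neg (norm_nonneg _)]
      norm_num
    have hWz : ‖W (wkbVar z)‖ ≤ (c ^ 2)⁻¹ * (‖eighthRoot z‖ ^ 20)⁻¹ := by
      refine (hW.2 _ hz.2.2).trans ?_
      rw [← mul_inv, show c ^ 2 * ‖eighthRoot z‖ ^ 20 = (c * ‖eighthRoot z‖ ^ 10) ^ 2 by ring]
      have hpos : 0 < c * ‖eighthRoot z‖ ^ 10 := by positivity
      gcongr
    have hs0 := sqrtSixth_ne_zero
    have key : ofNormalized W z / (Complex.I * (z / 6) ^ (1 / 2 : ℂ)) - 1 =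
        (-(1 / 48) * (eighthRoot z ^ 20)⁻¹ + (eighthRoot z ^ 5)⁻¹ * W (wkbVar z)) /
          (Complex.I * sqrtSixth) := by
      rw [sqrt_div_six hz0, ofNormalized]
      rw [show eighthRoot z ^ (-16 : ℤ) = (eighthRoot z ^ 16)⁻¹ by
        rw [zpow_neg]; norm_cast, zpow_neg_one, show eighthRoot z ^ (4 : ℤ) = eighthRoot z ^ 4 by
        norm_cast]
      field_simp
      ring
    have h5 : (‖eighthRoot z‖ ^ 5)⁻¹ ≤ 1 := inv_le_one_of_one_le₀ (one_le_pow₀ hq1)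
    rw [key, norm_div, norm_mul, Complex.norm_I, one_mul, Real.norm_of_nonneg (by positivity),
      hrpow, div_mul_eq_mul_div]
    gcongr
    refine (norm_add_le _ _).trans ?_
    rw [norm_mul, norm_mul, norm_inv, norm_inv, norm_pow, norm_pow, add_mul]
    refine add_le_add ?_ ((mul_le_of_le_one_left (norm_nonneg _) h5).trans hWz)
    norm_num

theorem mainTheorem7 :
    (∃ y : ℂ → ℂ, IsTritronquee y) ∧
    ∀ y : ℂ → ℂ, IsTritronquee y →
      (∃ (D : Set ℂ) (Y : ℂ → ℂ), IsContinuationToOrigin y D Y) ∧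
      ∀ (D : Set ℂ) (Y : ℂ → ℂ), IsContinuationToOrigin y D Y →
        (37 / 20 : ℝ≥0∞) ≤ (maclaurinSeries (rotated Y)).radius :=
  ⟨exists_isTritronquee, fun _ hy =>
    ⟨hy.exists_isContinuationToOrigin, fun _ _ hY => hY.le_radius hy⟩⟩

end
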